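/- Let $(M,\mu)$ be a finite measure space and let $\mathcal E$ be a Dirichlet form on the real space $L^2(M,\mu)$: a symmetric nonnegative bilinear form on a dense subspace $\mathcal D(\mathcal E)\subset L^2(M,\mu)$, closed (i.e. $\mathcal D(\mathcal E)$ is complete for the norm $(\mathcal E(v)+\|v\|_{L^2}^2)^{1/2}$, where $\mathcal E(v):=\mathcal E(v,v)$), and Markovian: if $v\in\mathcal D(\mathcal E)$ then $|v|\in\mathcal D(\mathcal E)$ and $\mathcal E(|v|)\le\mathcal E(v)$; and if moreover $v\ge 0$ then $\inf\{v,1\}\in\mathcal D(\mathcal E)$ and $\mathcal E(\inf\{v,1\})\le\mathcal E(v)$. Suppose that for some $\nu>2$ and some constants $A,B>0$ the Sobolev inequality $$\|v\|_{L^{2\nu/(\nu-2)}}^2\le A\,\mathcal E(v)+B\,\|v\|_{L^2}^2\qquad\text{for all } v\in\mathcal D(\mathcal E)$$ holds. Let $V$ be a real-valued integrable function on $M$ whose negative part $V_-=\sup\{0,-V\}$ is infinitesimally form bounded with respect to $\mathcal E$: for every $\varepsilon>0$ there is a constant $c(\varepsilon)$ such that $$\int_M V_-v^2\,d\mu\le\varepsilon\,\mathcal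 E(v)+c(\varepsilon)\int_M v^2\,d\mu\qquad\text{for all } v\in\mathcal D(\mathcal E).$$ Put $\mathcal D(\mathcal E_V)=\{v\in\mathcal D(\mathcal E):\int_M Vv^2\,d\mu<\infty\}$, $\mathcal E_V(v)=\mathcal E(v)+\int_M Vv^2\,d\mu$ for $v\in\mathcal D(\mathcal E_V)$, and $$Y(V)=\inf\{\mathcal E_V(v): v\in\mathcal D(\mathcal E_V),\ \|v\|_{L^{2\nu/(\nu-2)}}=1\}\in[-\infty,+\infty]\qquad(\inf\emptyset=+\infty).$$ If $Y(V)<1/A$, then there exists $v\in\mathcal D(\mathcal E_V)$ such that $\mathcal E_V(v)=Y(V)$ and $\|v\|_{L^{2\nu/(\nu-2)}}=1$. -/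

import Mathlib

open MeasureTheory Filter Topology

noncomputable section

/-- A (symmetric) Dirichlet form on the real Hilbert space `L²(M, μ)`, where `μ` is a finite measure:
a densely defined, nonnegative, closed, symmetric bilinear form with the Markov property,
the latter being expressed by the Beurling–Deny conditions. -/
structure DirichletForm {M : Type*} [MeasurableSpace M] (μ : Measure M) [IsFiniteMeasure μ] where
  /-- the form domain `𝓓(𝓔)` -/
  domain : Submodule ℝ (Lp ℝ 2 μ)
  /-- the bilinear form `𝓔(u, v)` -/
  form : domain →ₗ[ℝ] domain →ₗ[ℝ] ℝ
  dense_domain : Dense (domain : Set (Lp ℝ 2 μ))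
  symm : ∀ u v, form u v = form v u
  nonneg : ∀ v, 0 ≤ form v v
  /-- closedness: `𝓓(𝓔)` is complete for the norm `(𝓔(v, v) + ‖v‖²)^{1/2}` -/
  closed : ∀ u : ℕ → domain,
    Tendsto (fun p : ℕ × ℕ => form (u p.1 - u p.2) (u p.1 - u p.2) + ‖u p.1 - u p.2‖ ^ 2)
      atTop (𝓝 0) →
    ∃ w : domain, Tendsto (fun n => form (u n - w) (u n - w) + ‖u n - w‖ ^ 2) atTop (𝓝 0)
  /-- `v ∈ 𝓓(𝓔)` implies `|v| ∈ 𝓓(𝓔)` and `𝓔(|v|) ≤ 𝓔(v)` -/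
  abs_contraction : ∀ v : domain, ∃ w : domain,
    (w : Lp ℝ 2 μ) = |(v : Lp ℝ 2 μ)| ∧ form w w ≤ form v v
  /-- `0 ≤ v ∈ 𝓓(𝓔)` implies `inf {v, 1} ∈ 𝓓(𝓔)` and `𝓔(inf {v, 1}) ≤ 𝓔(v)` -/
  unit_contraction : ∀ v : domain, 0 ≤ (v : Lp ℝ 2 μ) → ∃ w : domain,
    (w : Lp ℝ 2 μ) = (v : Lp ℝ 2 μ) ⊓ Lp.const 2 μ (1 : ℝ) ∧ form w w ≤ form v v

/-- The Sobolev exponent `2ν / (ν - 2)`. -/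
def sobolevExponent (ν : ℝ) : ENNReal := ENNReal.ofReal (2 * ν / (ν - 2))

namespace DirichletForm

variable {M : Type*} [MeasurableSpace M] {μ : Measure M} [IsFiniteMeasure μ]

/-- The quadratic form `𝓔(v) = 𝓔(v, v)`. -/
def energy (E : DirichletForm μ) (v : E.domain) : ℝ := E.form v v

/-- The Sobolev inequality `‖v‖²_{L^{2ν/(ν-2)}} ≤ A 𝓔(v) + B ‖v‖²_{L²}` for all `v ∈ 𝓓(𝓔)`. -/
def SobolevInequality (E : DirichletForm μ) (ν A B : ℝ) : Prop :=
  ∀ v : E.domain, MemLp (v : Lp ℝ 2 μ) (sobolevExponent ν) μ ∧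
    (eLpNorm (v : Lp ℝ 2 μ) (sobolevExponent ν) μ).toReal ^ 2 ≤ A * E.energy v + B * ‖v‖ ^ 2

/-- Infinitesimal form boundedness of a nonnegative function `W` with respect to `𝓔`. -/
def InfinitesimallyFormBounded (E : DirichletForm μ) (W : M → ℝ) : Prop :=
  ∀ ε : ℝ, 0 < ε → ∃ c : ℝ, ∀ v : E.domain,
    Integrable (fun x => W x * (v : Lp ℝ 2 μ) x ^ 2) μ ∧
      ∫ x, W x * (v : Lp ℝ 2 μ) x ^ 2 ∂μ ≤ ε * E.energy v + c * ‖v‖ ^ 2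

/-- The domain `𝓓(𝓔_V)` of those `v ∈ 𝓓(𝓔)` with `∫ V v² < ∞`. (When `V₋` is form bounded,
`V₋ v²` is integrable for all `v ∈ 𝓓(𝓔)`, and `∫ V v² < ∞` says that `V v²` is integrable.) -/
def schrodingerDomain (E : DirichletForm μ) (V : M → ℝ) : Set E.domain :=
  {v | Integrable (fun x => V x * (v : Lp ℝ 2 μ) x ^ 2) μ}

/-- The quadratic form `𝓔_V(v) = 𝓔(v) + ∫ V v²`, meaningful for `v ∈ 𝓓(𝓔_V)`. -/
def schrodingerEnergy (E : DirichletForm μ) (V : M → ℝ) (v : E.domain) : ℝ :=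
  E.energy v + ∫ x, V x * (v : Lp ℝ 2 μ) x ^ 2 ∂μ

/-- The Yamabe invariant `Y(V)`: the infimum, in the extended reals, of `𝓔_V` over the
functions with `‖v‖_{L^{2ν/(ν-2)}} = 1`. Elements of `𝓓(𝓔)` outside `𝓓(𝓔_V)`, where `𝓔_V = +∞`,
do not contribute. -/
def yamabeInvariant (E : DirichletForm μ) (ν : ℝ) (V : M → ℝ) : EReal :=
  ⨅ v ∈ {v : E.domain | v ∈ E.schrodingerDomain V ∧
      eLpNorm (v : Lp ℝ 2 μ) (sobolevExponent ν) μ = 1},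
    (E.schrodingerEnergy V v : EReal)

end DirichletForm

end

/-!
Along a minimizing sequence `u n` of norm one, form boundedness of `V₋` controls the energies, so
after extraction `u n → v` weakly for the energy norm. The Sobolev inequality makes the convergence
strong in `L²`: truncating resolvents with the Markov property gives them a weak type bound, so a
resolvent sends bounded functions of small `L²` norm to functions of small `L^∞` norm. For bounded
`z n` tending weakly to zero, signed sums of `m` almost orthogonal terms have `L²` norm only of
order `√m`, and choosing the signs pointwise forces the resolvents of `z n` to zero in `L¹`.

Let `e` be the limiting energy of `u n - v`, let `p = 2ν / (ν - 2)` and `a = ∫ |v| ^ p ≤ 1`. Lower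
semicontinuity gives `Y a ^ (2 / p) + e ≤ 𝓔_V(v) + e ≤ Y`. The mass lost in the limit satisfies
`1 - a ≤ (A e) ^ (p / 2)` by the Brezis–Lieb lemma and the Sobolev inequality for `u n - v`, the
`L²` term of the latter tending to zero. As `1 ≤ a ^ (2 / p) + (1 - a) ^ (2 / p)`, the two estimates
are compatible with `Y < 1 / A` only if `a = 1`.
-/

noncomputable section

section WeakConvergence

variable {H F : Type*} [NormedAddCommGroup H] [InnerProductSpace ℝ H]
  [NormedAddCommGroup F] [InnerProductSpace ℝ F]

/-- Weak convergence of a sequence in a real inner product space, tested against vectors instead of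
functionals so that completeness is not needed to state it. -/
def TendstoWeakly (u : ℕ → H) (v : H) : Prop :=
  ∀ w, Tendsto (fun n => inner ℝ (u n) w) atTop (𝓝 (inner ℝ v w))

namespace TendstoWeakly

theorem comp {u : ℕ → H} {v : H} (hu : TendstoWeakly u v) {φ : ℕ → ℕ}
    (hφ : Tendsto φ atTop atTop) : TendstoWeakly (u ∘ φ) v :=
  fun w => (hu w).comp hφ

theorem sub_const {u : ℕ → H} {v : H} (hu : TendstoWeakly u v) (a : H) :
    TendstoWeakly (fun n => u n - a) (v - a) := fun w => by
  simpa only [inner_sub_left] using (hu w).sub_const (inner ℝ a w)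

theorem sub_limit {u : ℕ → H} {v : H} (hu : TendstoWeakly u v) :
    TendstoWeakly (fun n => u n - v) 0 := by
  simpa only [sub_self] using hu.sub_const v

theorem map [CompleteSpace H] [CompleteSpace F] {u : ℕ → H} {v : H} (hu : TendstoWeakly u v)
    (T : H →L[ℝ] F) : TendstoWeakly (fun n => T (u n)) (T v) := fun w => by
  simpa only [ContinuousLinearMap.adjoint_inner_right] using hu (ContinuousLinearMap.adjoint T w)

theorem inner_tendsto_zero {u : ℕ → H} (hu : TendstoWeakly u 0) (w : H) :
    Tendsto (fun n => inner ℝ (u n) w) atTop (𝓝 0) := by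
  simpa only [inner_zero_left] using hu w

theorem tendsto_norm_sub_sq {u : ℕ → H} {v : H} (hu : TendstoWeakly u v) {l : ℝ}
    (hl : Tendsto (fun n => ‖u n‖ ^ 2) atTop (𝓝 l)) :
    Tendsto (fun n => ‖u n - v‖ ^ 2) atTop (𝓝 (l - ‖v‖ ^ 2)) := by
  have hlim := (hl.sub ((hu v).const_mul 2)).add_const (‖v‖ ^ 2)
  rw [real_inner_self_eq_norm_sq, show l - 2 * ‖v‖ ^ 2 + ‖v‖ ^ 2 = l - ‖v‖ ^ 2 by ring] at hlim
  simpa only [norm_sub_sq_real] using hlim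

end TendstoWeakly

theorem exists_subseq_tendstoWeakly_of_separable [CompleteSpace H]
    [TopologicalSpace.SeparableSpace H] {u : ℕ → H} {R : ℝ} (hu : ∀ n, ‖u n‖ ≤ R) :
    ∃ (v : H) (φ : ℕ → ℕ), StrictMono φ ∧ TendstoWeakly (u ∘ φ) v := by
  let toWeak : H → WeakDual ℝ H := fun x => StrongDual.toWeakDual (InnerProductSpace.toDual ℝ H x)
  obtain ⟨ℓ, -, φ, hφ, hlim⟩ := WeakDual.isSeqCompact_closedBall ℝ H (0 : StrongDual ℝ H) R
    (x := toWeak ∘ u) fun n => by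
      rw [Set.mem_preimage, mem_closedBall_zero_iff]
      exact ((InnerProductSpace.toDual ℝ H).norm_map (u n)).le.trans (hu n)
  refine ⟨(InnerProductSpace.toDual ℝ H).symm (WeakDual.toStrongDual ℓ), φ, hφ, fun w => ?_⟩
  rw [InnerProductSpace.toDual_symm_apply]
  exact ((WeakDual.eval_continuous w).tendsto ℓ).comp hlim

theorem exists_subseq_tendstoWeakly [CompleteSpace H] {u : ℕ → H} {R : ℝ}
    (hu : ∀ n, ‖u n‖ ≤ R) :
    ∃ (v : H) (φ : ℕ → ℕ), StrictMono φ ∧ TendstoWeakly (u ∘ φ) v := by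
  let K : Submodule ℝ H := (Submodule.span ℝ (Set.range u)).topologicalClosure
  have : CompleteSpace K := (Submodule.isClosed_topologicalClosure _).completeSpace_coe
  have hsep : TopologicalSpace.IsSeparable (K : Set H) :=
    (Set.countable_range u).isSeparable.span.closure
  have : TopologicalSpace.SeparableSpace K := hsep.separableSpace
  have huK (n : ℕ) : u n ∈ K :=
    Submodule.le_topologicalClosure _ (Submodule.subset_span ⟨n, rfl⟩)
  obtain ⟨v, φ, hφ, hv⟩ := exists_subseq_tendstoWeakly_of_separable
    (u := fun n => (⟨u n, huK n⟩ : K)) hu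
  exact ⟨v, φ, hφ, hv.map K.subtypeL⟩

theorem exists_norm_signed_sum_sq_le {z : ℕ → H} (hz : TendstoWeakly z 0) {K : ℝ}
    (hK : ∀ n, ‖z n‖ ≤ K) (m : ℕ) :
    ∃ f : Fin m → ℕ, ∀ σ : Fin m → SignType,
      ‖∑ i, ((σ i : SignType) : ℝ) • z (f i)‖ ^ 2 ≤ m * (K ^ 2 + 1) := by
  induction m with
  | zero => exact ⟨Fin.elim0, fun σ => by simp⟩
  | succ m ih =>
    obtain ⟨f, hf⟩ := ih
    have hcross (σ : Fin m → SignType) :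
        ∀ᶠ n in atTop, |inner ℝ (z n) (∑ i, ((σ i : SignType) : ℝ) • z (f i))| < 1 / 2 := by
      have hzero := (hz.inner_tendsto_zero (∑ i, ((σ i : SignType) : ℝ) • z (f i))).abs
      rw [abs_zero] at hzero
      exact hzero.eventually (gt_mem_nhds (by norm_num))
    obtain ⟨n, hn⟩ := (eventually_all.2 hcross).exists
    refine ⟨Fin.snoc f n, fun σ => ?_⟩
    have hsign : |((σ (Fin.last m) : SignType) : ℝ)| ≤ 1 := by cases σ (Fin.last m) <;> simp
    have hlast : ‖((σ (Fin.last m) : SignType) : ℝ) • z n‖ ^ 2 ≤ K ^ 2 := by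
      rw [norm_smul, Real.norm_eq_abs]
      exact pow_le_pow_left₀ (by positivity)
        ((mul_le_of_le_one_left (norm_nonneg _) hsign).trans (hK n)) 2
    have hcrossσ : ((σ (Fin.last m) : SignType) : ℝ) *
        inner ℝ (z n) (∑ i, ((σ i.castSucc : SignType) : ℝ) • z (f i)) ≤ 1 / 2 :=
      calc _ ≤ |_| := le_abs_self _
        _ = _ := abs_mul _ _
        _ ≤ |_| := mul_le_of_le_one_left (abs_nonneg _) hsign
        _ ≤ 1 / 2 := (hn fun i => σ i.castSucc).le
    have hinit := hf fun i => σ i.castSucc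
    simp only [Fin.sum_univ_castSucc, Fin.snoc_castSucc, Fin.snoc_last]
    rw [norm_add_sq_real, inner_smul_right, real_inner_comm]
    push_cast
    linarith

end WeakConvergence

section LpTwo

variable {M : Type*} [MeasurableSpace M] {μ : Measure M}

theorem inner_lp_eq_integral_mul (f g : Lp ℝ 2 μ) : inner ℝ f g = ∫ x, f x * g x ∂μ := by
  simp only [L2.inner_def, Real.inner_apply]

theorem integrable_lp_mul (f g : Lp ℝ 2 μ) : Integrable (fun x => f x * g x) μ := by
  simpa only [Real.inner_apply] using L2.integrable_inner (𝕜 := ℝ) f g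

theorem norm_lp_sq_eq_integral_sq (f : Lp ℝ 2 μ) : ‖f‖ ^ 2 = ∫ x, f x ^ 2 ∂μ := by
  rw [← real_inner_self_eq_norm_sq, inner_lp_eq_integral_mul]
  simp only [sq]

theorem inner_lp_nonneg {f g : Lp ℝ 2 μ} (hf : 0 ≤ f) (hg : 0 ≤ g) : 0 ≤ inner ℝ f g := by
  rw [inner_lp_eq_integral_mul]
  refine integral_nonneg_of_ae ?_
  filter_upwards [(Lp.coeFn_nonneg f).2 hf, (Lp.coeFn_nonneg g).2 hg] with x hfx hgx
  exact mul_nonneg hfx hgx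

theorem ae_abs_map_le_mul {T : Lp ℝ 2 μ →ₗ[ℝ] Lp ℝ 2 μ} {N η δ : ℝ} (hN : 0 < N)
    (hδ : ∀ g : Lp ℝ 2 μ, (∀ᵐ x ∂μ, |g x| ≤ 1) → ‖g‖ ≤ δ → ∀ᵐ x ∂μ, |T g x| ≤ η)
    {g : Lp ℝ 2 μ} (hg : ∀ᵐ x ∂μ, |g x| ≤ N) (hgδ : ‖g‖ ≤ N * δ) :
    ∀ᵐ x ∂μ, |T g x| ≤ N * η := by
  have hscaled := hδ (N⁻¹ • g) ?_ ?_
  · rw [map_smul] at hscaled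
    filter_upwards [hscaled, Lp.coeFn_smul N⁻¹ (T g)] with x hx hsmul
    rwa [hsmul, Pi.smul_apply, smul_eq_mul, abs_mul, abs_of_pos (inv_pos.2 hN),
      inv_mul_le_iff₀ hN] at hx
  · filter_upwards [hg, Lp.coeFn_smul N⁻¹ g] with x hx hsmul
    rwa [hsmul, Pi.smul_apply, smul_eq_mul, abs_mul, abs_of_pos (inv_pos.2 hN),
      inv_mul_le_iff₀ hN, mul_one]
  · rwa [norm_smul, Real.norm_of_nonneg (inv_pos.2 hN).le, inv_mul_le_iff₀ hN]

theorem ae_abs_signed_sum_le {m : ℕ} {y : Fin m → Lp ℝ 2 μ} {N : ℝ}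
    (hy : ∀ i, ∀ᵐ x ∂μ, |y i x| ≤ N)
    (σ : Fin m → SignType) : ∀ᵐ x ∂μ, |(∑ i, (σ i : ℝ) • y i) x| ≤ m * N := by
  filter_upwards [ae_all_iff.2 hy,
    Lp.coeFn_finsetSum Finset.univ fun i => (σ i : ℝ) • y i,
    ae_all_iff.2 fun i => Lp.coeFn_smul (σ i : ℝ) (y i)] with x hx hsum hsmul
  rw [hsum, Finset.sum_apply]
  calc |∑ i, ((σ i : ℝ) • y i) x| ≤ ∑ i, |((σ i : ℝ) • y i) x| :=
        Finset.abs_sum_le_sum_abs _ _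
    _ ≤ ∑ _i : Fin m, N := Finset.sum_le_sum fun i _ => by
        rw [hsmul, Pi.smul_apply, smul_eq_mul, abs_mul]
        refine (mul_le_of_le_one_left (abs_nonneg _) ?_).trans (hx i)
        cases σ i <;> simp
    _ = m * N := by simp

/-- Choosing the signs pointwise turns a uniform bound for all signed sums into one for the sum of
the absolute values. -/
theorem ae_sum_abs_le_of_signed_sum {m : ℕ} {y : Fin m → Lp ℝ 2 μ} {c : ℝ}
    (hy : ∀ σ : Fin m → SignType, ∀ᵐ x ∂μ, |(∑ i, (σ i : ℝ) • y i) x| ≤ c) :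
    ∀ᵐ x ∂μ, ∑ i, |y i x| ≤ c := by
  have hsum (σ : Fin m → SignType) := Lp.coeFn_finsetSum Finset.univ
    fun i => (σ i : ℝ) • y i
  have hsmul (σ : Fin m → SignType) (i : Fin m) := Lp.coeFn_smul (σ i : ℝ) (y i)
  filter_upwards [ae_all_iff.2 hy, ae_all_iff.2 hsum,
    ae_all_iff.2 fun σ => ae_all_iff.2 (hsmul σ)] with x hx hsumx hsmulx
  let σ : Fin m → SignType := fun i => SignType.sign (y i x)
  calc ∑ i, |y i x| = (∑ i, (σ i : ℝ) • y i) x := by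
        rw [hsumx, Finset.sum_apply]
        refine Finset.sum_congr rfl fun i _ => ?_
        rw [hsmulx, Pi.smul_apply, smul_eq_mul, sign_mul_self]
    _ ≤ c := (le_abs_self _).trans (hx σ)

/-- A linear operator on `L²` smooths bounded functions if, on the unit ball of `L^∞`, a small `L²`
norm forces a small `L^∞` norm of the image. Resolvents with this property embed the form domain
compactly into `L²`. -/
def SmoothsBoundedFunctions (T : Lp ℝ 2 μ →ₗ[ℝ] Lp ℝ 2 μ) : Prop :=
  ∀ η : ℝ, 0 < η → ∃ δ : ℝ, 0 < δ ∧ ∀ g : Lp ℝ 2 μ, (∀ᵐ x ∂μ, |g x| ≤ 1) → ‖g‖ ≤ δ →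
    ∀ᵐ x ∂μ, |T g x| ≤ η

variable [IsFiniteMeasure μ]

theorem integrable_lp (f : Lp ℝ 2 μ) : Integrable f μ := (Lp.memLp f).integrable (by norm_num)

theorem integral_abs_le_norm_mul (f : Lp ℝ 2 μ) :
    ∫ x, |f x| ∂μ ≤ ‖f‖ * ‖Lp.const 2 μ (1 : ℝ)‖ := by
  have hinner : ∫ x, |f x| ∂μ = inner ℝ |f| (Lp.const 2 μ (1 : ℝ)) := by
    rw [inner_lp_eq_integral_mul]
    refine integral_congr_ae ?_
    filter_upwards [Lp.coeFn_abs f, Lp.coeFn_const (p := 2) (μ := μ) (1 : ℝ)] with x habs hone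
    rw [habs, hone, Function.const_apply, mul_one]
  calc ∫ x, |f x| ∂μ ≤ ‖|f|‖ * ‖Lp.const 2 μ (1 : ℝ)‖ := hinner ▸ real_inner_le_norm _ _
    _ = ‖f‖ * ‖Lp.const 2 μ (1 : ℝ)‖ := by rw [norm_abs_eq_norm]

theorem inner_lp_le_mul_integral_abs_add {g u : Lp ℝ 2 μ} (hg : ∀ᵐ x ∂μ, |g x| ≤ 1)
    (hu : 0 ≤ u) (k : ℝ) :
    inner ℝ g u ≤ k * ∫ x, |g x| ∂μ + ∫ x, max (u x - k) 0 ∂μ := by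
  have hint : Integrable (fun x => max (u x - k) 0) μ :=
    ((integrable_lp u).sub (integrable_const k)).pos_part
  rw [inner_lp_eq_integral_mul, ← integral_const_mul,
    ← integral_add ((integrable_lp g).abs.const_mul k) hint]
  refine integral_mono_ae (integrable_lp_mul g u)
    (((integrable_lp g).abs.const_mul k).add hint) ?_
  filter_upwards [hg, (Lp.coeFn_nonneg u).2 hu] with x hgx hux
  have hlayer : u x ≤ k + max (u x - k) 0 := by linarith [le_max_left (u x - k) 0]
  calc g x * u x ≤ |g x| * u x := mul_le_mul_of_nonneg_right (le_abs_self _) hux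
    _ ≤ |g x| * (k + max (u x - k) 0) := by gcongr
    _ ≤ k * |g x| + max (u x - k) 0 := by
        linarith [mul_le_of_le_one_left (le_max_right (u x - k) 0) hgx]

theorem ae_le_of_tendstoWeakly {f : ℕ → Lp ℝ 2 μ} {g : Lp ℝ 2 μ} {N : ℝ}
    (hg : TendstoWeakly f g) (hf : ∀ n, ∀ᵐ x ∂μ, f n x ≤ N) : ∀ᵐ x ∂μ, g x ≤ N := by
  refine ae_le_of_forall_setIntegral_le (g := fun _ => N) (integrable_lp g) (integrable_const _)
    fun s hs hμs => ?_
  have hinner (u : Lp ℝ 2 μ) :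
      inner ℝ u (indicatorConstLp 2 hs hμs.ne (1 : ℝ)) = ∫ x in s, u x ∂μ := by
    rw [real_inner_comm]
    exact L2.inner_indicatorConstLp_one hs hμs.ne u
  have hlim := hg (indicatorConstLp 2 hs hμs.ne (1 : ℝ))
  simp only [hinner] at hlim
  exact le_of_tendsto' hlim fun n =>
    setIntegral_mono_ae (integrable_lp _).integrableOn (integrable_const _).integrableOn (hf n)

theorem ae_abs_le_of_tendstoWeakly {f : ℕ → Lp ℝ 2 μ} {g : Lp ℝ 2 μ} {N : ℝ}
    (hg : TendstoWeakly f g) (hf : ∀ n, ∀ᵐ x ∂μ, |f n x| ≤ N) : ∀ᵐ x ∂μ, |g x| ≤ N := by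
  have hneg : TendstoWeakly (fun n => -f n) (-g) := fun w => by
    simpa only [inner_neg_left] using (hg w).neg
  have hneg_le := ae_le_of_tendstoWeakly (N := N) hneg fun n => by
    filter_upwards [hf n, Lp.coeFn_neg (f n)] with x hx hn
    exact hn ▸ (neg_le_abs _).trans hx
  filter_upwards [hneg_le, Lp.coeFn_neg g,
    ae_le_of_tendstoWeakly hg fun n => (hf n).mono fun x hx => (le_abs_self _).trans hx]
    with x hx hn hle
  rw [hn, Pi.neg_apply] at hx
  exact abs_le'.2 ⟨hle, hx⟩

namespace SmoothsBoundedFunctions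

variable {T : Lp ℝ 2 μ →ₗ[ℝ] Lp ℝ 2 μ} {z : ℕ → Lp ℝ 2 μ} {N : ℝ}

theorem exists_integral_abs_le (hT : SmoothsBoundedFunctions T) (hz : TendstoWeakly z 0)
    (hN : 0 < N) (hzN : ∀ n, ∀ᵐ x ∂μ, |z n x| ≤ N) {η : ℝ} (hη : 0 < η) :
    ∃ n, ∫ x, |T (z n) x| ∂μ ≤ N * η * μ.real Set.univ := by
  obtain ⟨δ, hδ0, hδ⟩ := hT η hη
  obtain ⟨K, hK⟩ : ∃ K, ∀ n, ‖z n‖ ≤ K := ⟨_, fun n => Lp.norm_le_of_ae_bound hN.le (hzN n)⟩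
  obtain ⟨m, hm⟩ := exists_nat_gt ((K ^ 2 + 1) / (N * δ) ^ 2)
  have hm0 : (0 : ℝ) < m := lt_of_le_of_lt (by positivity) hm
  obtain ⟨f, hf⟩ := exists_norm_signed_sum_sq_le hz hK m
  have hsum : ∀ᵐ x ∂μ, ∑ i, |T (z (f i)) x| ≤ m * N * η := ae_sum_abs_le_of_signed_sum fun σ => by
    simp only [← map_smul, ← map_sum]
    refine ae_abs_map_le_mul (by positivity) hδ (ae_abs_signed_sum_le (fun i => hzN (f i)) σ)
      (abs_le_of_sq_le_sq' ?_ (by positivity)).2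
    rw [div_lt_iff₀ (by positivity)] at hm
    calc _ ≤ m * (K ^ 2 + 1) := hf σ
      _ ≤ m * (m * (N * δ) ^ 2) := by gcongr
      _ = (m * N * δ) ^ 2 := by ring
  have hint : ∑ i, ∫ x, |T (z (f i)) x| ∂μ ≤ ∑ _i : Fin m, N * η * μ.real Set.univ := by
    rw [← integral_finsetSum _ fun i _ => (integrable_lp _).abs]
    refine (integral_mono_ae (integrable_finsetSum _ fun i _ => (integrable_lp _).abs)
      (integrable_const _) hsum).trans_eq ?_
    rw [integral_const, smul_eq_mul, Finset.sum_const, Finset.card_univ, Fintype.card_fin,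
      nsmul_eq_mul]
    ring
  have hne : (Finset.univ : Finset (Fin m)).Nonempty :=
    ⟨⟨0, by exact_mod_cast hm0⟩, Finset.mem_univ _⟩
  obtain ⟨i, -, hi⟩ := Finset.exists_le_of_sum_le hne hint
  exact ⟨f i, hi⟩

theorem tendsto_integral_abs (hT : SmoothsBoundedFunctions T) (hz : TendstoWeakly z 0)
    (hN : 0 < N) (hzN : ∀ n, ∀ᵐ x ∂μ, |z n x| ≤ N) :
    Tendsto (fun n => ∫ x, |T (z n) x| ∂μ) atTop (𝓝 0) := by
  refine tendsto_order.2 ⟨fun a ha => .of_forall fun n =>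
    ha.trans_le (integral_nonneg fun x => abs_nonneg _), fun ε hε => ?_⟩
  by_contra hfreq
  obtain ⟨φ, hφ, hlarge⟩ := extraction_of_frequently_atTop (not_eventually.1 hfreq)
  obtain ⟨n, hn⟩ := hT.exists_integral_abs_le (hz.comp hφ.tendsto_atTop) hN
    (fun n => hzN (φ n)) (η := ε / (2 * N * (μ.real Set.univ + 1))) (by positivity)
  refine hlarge n (hn.trans_lt ?_)
  have hμ : 0 ≤ μ.real Set.univ := measureReal_nonneg
  rw [mul_div_assoc', div_mul_eq_mul_div, div_lt_iff₀ (by positivity)]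
  nlinarith [mul_pos hN hε, mul_nonneg (mul_pos hN hε).le hμ]

end SmoothsBoundedFunctions

end LpTwo

section WeakTypeTail

variable {M : Type*} [MeasurableSpace M] {μ : Measure M}

theorem rpow_mul_measureReal_le_eLpNorm_rpow {p : ℝ} (hp : 0 < p) {w : M → ℝ}
    (hw : MemLp w (ENNReal.ofReal p) μ) {c : ℝ} (hc : 0 < c) :
    c ^ p * μ.real {x | c ≤ |w x|} ≤ (eLpNorm w (ENNReal.ofReal p) μ).toReal ^ p := by
  have hchebyshev := mul_meas_ge_le_pow_eLpNorm' μ (p := ENNReal.ofReal p) (by simpa using hp)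
    ENNReal.ofReal_ne_top hw.1 (ENNReal.ofReal c)
  have hset : {x | ENNReal.ofReal c ≤ ‖w x‖ₑ} = {x | c ≤ |w x|} := by
    simp only [← ofReal_norm, Real.norm_eq_abs, ENNReal.ofReal_le_ofReal_iff (abs_nonneg _)]
  rw [ENNReal.toReal_ofReal hp.le, hset] at hchebyshev
  have hreal := ENNReal.toReal_mono (ENNReal.rpow_ne_top_of_nonneg hp.le hw.2.ne) hchebyshev
  rwa [ENNReal.toReal_mul, ← ENNReal.toReal_rpow, ← ENNReal.toReal_rpow,
    ENNReal.toReal_ofReal hc.le] at hreal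

theorem integral_max_sub_le_of_measureReal_le [IsFiniteMeasure μ] {u : M → ℝ}
    (hu : Integrable u μ) {q D k : ℝ} (hq : 1 < q) (hk : 0 < k)
    (hD : ∀ t, k < t → μ.real {x | t ≤ u x} ≤ D * t ^ (-q)) :
    ∫ x, max (u x - k) 0 ∂μ ≤ D * (k ^ (1 - q) / (q - 1)) := by
  have hlevel (t : ℝ) (ht : 0 < t) : {x | t ≤ max (u x - k) 0} = {x | t + k ≤ u x} := by
    ext x
    simp only [Set.mem_ofPred_eq, le_max_iff, ht.not_ge, or_false, le_sub_iff_add_le]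
  have hint : Integrable (fun x => max (u x - k) 0) μ := (hu.sub (integrable_const k)).pos_part
  rw [hint.integral_eq_integral_meas_le (.of_forall fun x => le_max_right _ _)]
  calc ∫ t in Set.Ioi 0, μ.real {x | t ≤ max (u x - k) 0}
      ≤ ∫ t in Set.Ioi 0, D * (t + k) ^ (-q) := by
        refine integral_mono_of_nonneg (.of_forall fun t => measureReal_nonneg)
          ((integrableOn_add_rpow_Ioi_of_lt (by linarith) (by linarith)).const_mul D) ?_
        filter_upwards [self_mem_ae_restrict measurableSet_Ioi] with t ht
        rw [hlevel t ht]
        exact hD _ (lt_add_of_pos_left k ht)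
    _ = ∫ t in Set.Ioi k, D * t ^ (-q) := by
        have hshift := (measurePreserving_add_right volume k).setIntegral_preimage_emb
          (MeasurableEquiv.addRight k).measurableEmbedding (fun t => D * t ^ (-q)) (Set.Ioi k)
        rwa [Set.preimage_add_const_Ioi, sub_self] at hshift
    _ = D * (k ^ (1 - q) / (q - 1)) := by
        rw [integral_const_mul, integral_Ioi_rpow_of_lt (by linarith) hk, neg_add_eq_sub,
          ← neg_sub q 1, div_neg, neg_div, neg_neg]

end WeakTypeTail

namespace DirichletForm

variable {M : Type*} [MeasurableSpace M] {μ : Measure M} [IsFiniteMeasure μ]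

/-- The form domain, to be equipped with the inner product `𝓔(u, v) + ⟪u, v⟫`. -/
def FormSpace (E : DirichletForm μ) : Type _ := E.domain

namespace FormSpace

variable (E : DirichletForm μ)

instance : AddCommGroup (FormSpace E) := inferInstanceAs (AddCommGroup E.domain)

instance : Module ℝ (FormSpace E) := inferInstanceAs (Module ℝ E.domain)

/-- The identity, as a map from the form space to the form domain. It is kept explicit because the
two types carry different norms. -/
def toDomain : FormSpace E ≃ₗ[ℝ] E.domain := LinearEquiv.refl ℝ E.domain

/-- The inner product `𝓔(u, v) + ⟪u, v⟫`, for which closedness of the form is completeness. -/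
abbrev core : InnerProductSpace.Core ℝ (FormSpace E) where
  inner u v := E.form (toDomain E u) (toDomain E v) + inner ℝ (toDomain E u) (toDomain E v)
  conj_inner_symm u v := by
    simp only [conj_trivial]
    rw [E.symm, real_inner_comm]
  re_inner_nonneg u := add_nonneg (E.nonneg _) real_inner_self_nonneg
  add_left u v w := by
    simp only [map_add, LinearMap.add_apply, inner_add_left]
    ring
  smul_left u v r := by
    have hinner : inner ℝ (r • toDomain E u) (toDomain E v) =
        r * inner ℝ (toDomain E u) (toDomain E v) :=
      real_inner_smul_left (toDomain E u : Lp ℝ 2 μ) (toDomain E v : Lp ℝ 2 μ) r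
    simp only [map_smul, LinearMap.smul_apply, conj_trivial, smul_eq_mul, hinner]
    ring
  definite u hu := by
    have hinner : inner ℝ (toDomain E u) (toDomain E u) = 0 :=
      ((add_eq_zero_iff_of_nonneg (E.nonneg _) real_inner_self_nonneg).1 hu).2
    exact (toDomain E).map_eq_zero_iff.1 (inner_self_eq_zero.1 hinner)

instance : NormedAddCommGroup (FormSpace E) :=
  InnerProductSpace.Core.toNormedAddCommGroup (cd := core E)

instance : InnerProductSpace ℝ (FormSpace E) := InnerProductSpace.ofCore (core E).toCore

theorem inner_def (u v : FormSpace E) :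
    inner ℝ u v = E.form (toDomain E u) (toDomain E v) +
      inner ℝ (toDomain E u) (toDomain E v) := rfl

theorem norm_sq (u : FormSpace E) :
    ‖u‖ ^ 2 = E.form (toDomain E u) (toDomain E u) + ‖toDomain E u‖ ^ 2 := by
  rw [← real_inner_self_eq_norm_sq, inner_def, real_inner_self_eq_norm_sq]

instance : CompleteSpace (FormSpace E) := by
  refine Metric.complete_of_cauchySeq_tendsto fun u hu => ?_
  have hcauchy := (cauchySeq_iff_tendsto_dist_atTop_0.1 hu).pow 2
  simp only [dist_eq_norm, norm_sq, map_sub (toDomain E), zero_pow two_ne_zero] at hcauchy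
  obtain ⟨w, hw⟩ := E.closed (fun n => toDomain E (u n)) hcauchy
  have hsq : Tendsto (fun n => ‖u n - (toDomain E).symm w‖ ^ 2) atTop (𝓝 0) := by
    simpa only [norm_sq, map_sub, LinearEquiv.apply_symm_apply] using hw
  refine ⟨(toDomain E).symm w, tendsto_iff_norm_sub_tendsto_zero.2 ?_⟩
  simpa only [Real.sqrt_sq (norm_nonneg _), Real.sqrt_zero] using hsq.sqrt

/-- The inclusion of the form space into `L²`. -/
def toLp : FormSpace E →L[ℝ] Lp ℝ 2 μ :=
  LinearMap.mkContinuous (E.domain.subtype ∘ₗ (toDomain E).toLinearMap) 1 fun u => by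
    rw [one_mul]
    change ‖toDomain E u‖ ≤ ‖u‖
    refine (abs_le_of_sq_le_sq' ?_ (norm_nonneg _)).2
    rw [norm_sq]
    exact le_add_of_nonneg_left (E.nonneg _)

end FormSpace

section Form

variable (E : DirichletForm μ)

theorem coeFn_domain_sub (u v : E.domain) :
    ((u - v : E.domain) : Lp ℝ 2 μ) =ᵐ[μ] fun x => (u : Lp ℝ 2 μ) x - (v : Lp ℝ 2 μ) x :=
  Lp.coeFn_sub (u : Lp ℝ 2 μ) (v : Lp ℝ 2 μ)

theorem coeFn_domain_smul (c : ℝ) (v : E.domain) :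
    ((c • v : E.domain) : Lp ℝ 2 μ) =ᵐ[μ] fun x => c * (v : Lp ℝ 2 μ) x :=
  Lp.coeFn_smul c (v : Lp ℝ 2 μ)

theorem coeFn_domain_add (u v : E.domain) :
    ((u + v : E.domain) : Lp ℝ 2 μ) =ᵐ[μ] fun x => (u : Lp ℝ 2 μ) x + (v : Lp ℝ 2 μ) x :=
  Lp.coeFn_add (u : Lp ℝ 2 μ) (v : Lp ℝ 2 μ)

theorem form_add_self (u v : E.domain) :
    E.form (u + v) (u + v) = E.form u u + 2 * E.form u v + E.form v v := by
  simp only [map_add, LinearMap.add_apply]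
  rw [E.symm v u]
  ring

theorem form_sub_self (u v : E.domain) :
    E.form (u - v) (u - v) = E.form u u - 2 * E.form u v + E.form v v := by
  simp only [map_sub, LinearMap.sub_apply]
  rw [E.symm v u]
  ring

theorem form_smul_self (c : ℝ) (u : E.domain) :
    E.form (c • u) (c • u) = c ^ 2 * E.form u u := by
  simp only [map_smul, LinearMap.smul_apply, smul_eq_mul]
  ring

theorem form_nonneg_of_forall_le_form_add_smul {a d : E.domain}
    (h : ∀ t : ℝ, 0 < t → E.form a a ≤ E.form (a + t • d) (a + t • d)) : 0 ≤ E.form a d := by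
  have hderiv (t : ℝ) (ht : 0 < t) : 0 ≤ 2 * E.form a d + t * E.form d d := by
    have hle := h t ht
    rw [form_add_self, form_smul_self, map_smul, smul_eq_mul] at hle
    exact nonneg_of_mul_nonneg_right (by linarith) ht
  have hlim : Tendsto (fun t : ℝ => 2 * E.form a d + t * E.form d d) (𝓝[>] 0)
      (𝓝 (2 * E.form a d + 0 * E.form d d)) :=
    (Continuous.tendsto (by fun_prop) 0).mono_left nhdsWithin_le_nhds
  linarith [ge_of_tendsto hlim (eventually_mem_nhdsWithin.mono hderiv)]

theorem exists_min_const {v : E.domain} (hv : 0 ≤ (v : Lp ℝ 2 μ)) {k : ℝ} (hk : 0 < k) :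
    ∃ a : E.domain, ((a : Lp ℝ 2 μ) =ᵐ[μ] fun x => min ((v : Lp ℝ 2 μ) x) k) ∧
      E.form a a ≤ E.form v v := by
  have hscaled_nonneg : 0 ≤ ((k⁻¹ • v : E.domain) : Lp ℝ 2 μ) := by
    rw [← Lp.coeFn_nonneg] at hv ⊢
    filter_upwards [hv, E.coeFn_domain_smul k⁻¹ v] with x hvx hsmul
    exact hsmul ▸ mul_nonneg (inv_nonneg.2 hk.le) hvx
  obtain ⟨w, hw, hle⟩ := E.unit_contraction (k⁻¹ • v) hscaled_nonneg
  refine ⟨k • w, ?_, ?_⟩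
  · have hinf := Lp.coeFn_inf ((k⁻¹ • v : E.domain) : Lp ℝ 2 μ) (Lp.const 2 μ (1 : ℝ))
    rw [← hw] at hinf
    filter_upwards [hinf, E.coeFn_domain_smul k w, E.coeFn_domain_smul k⁻¹ v,
      Lp.coeFn_const (p := 2) (μ := μ) (1 : ℝ)] with x hinfx hkw hkv hone
    rw [hkw, hinfx, Pi.inf_apply, hkv, hone, Function.const_apply, mul_min_of_nonneg _ _ hk.le,
      mul_inv_cancel_left₀ hk.ne', mul_one]
  · rw [form_smul_self] at hle ⊢
    calc k ^ 2 * E.form w w ≤ k ^ 2 * (k⁻¹ ^ 2 * E.form v v) := by gcongr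
      _ = E.form v v := by field_simp

theorem form_min_const_sub_nonneg {v a : E.domain} (hv : 0 ≤ (v : Lp ℝ 2 μ)) {k : ℝ} (hk : 0 < k)
    (ha : (a : Lp ℝ 2 μ) =ᵐ[μ] fun x => min ((v : Lp ℝ 2 μ) x) k) :
    0 ≤ E.form a (v - a) := by
  -- Truncating `a + t (v - a)` at `k` gives back `a`, so `a` minimizes the form on this ray.
  refine E.form_nonneg_of_forall_le_form_add_smul fun t ht => ?_
  have hray : ((a + t • (v - a) : E.domain) : Lp ℝ 2 μ) =ᵐ[μ] fun x =>
      min ((v : Lp ℝ 2 μ) x) k + t * ((v : Lp ℝ 2 μ) x - min ((v : Lp ℝ 2 μ) x) k) := by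
    filter_upwards [ha, E.coeFn_domain_add a (t • (v - a)), E.coeFn_domain_smul t (v - a),
      E.coeFn_domain_sub v a] with x hax hadd hsmul hsub
    rw [hadd, hsmul, hsub, hax]
  have hray_nonneg : 0 ≤ ((a + t • (v - a) : E.domain) : Lp ℝ 2 μ) := by
    rw [← Lp.coeFn_nonneg] at hv ⊢
    filter_upwards [hray, hv] with x hx hvx
    exact hx ▸ add_nonneg (le_min hvx hk.le)
      (mul_nonneg ht.le (sub_nonneg.2 (min_le_left _ _)))
  obtain ⟨b, hb, hle⟩ := E.exists_min_const hray_nonneg hk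
  have hba : b = a := by
    refine Subtype.ext (Lp.ext ?_)
    filter_upwards [hb, hray, ha] with x hbx hx hax
    rw [hbx, hx, hax]
    rcases le_total ((v : Lp ℝ 2 μ) x) k with hvk | hvk
    · simp only [min_eq_left hvk, sub_self, mul_zero, add_zero]
    · rw [min_eq_right hvk, min_eq_right]
      exact le_add_of_nonneg_right (mul_nonneg ht.le (sub_nonneg.2 hvk))
  rwa [hba] at hle

end Form

section Resolvent

open FormSpace

variable (E : DirichletForm μ)

/-- The resolvent `(1 + L)⁻¹` of the generator `L` of the form, obtained as the adjoint of the
embedding of the form space into `L²`. -/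
def resolvent : Lp ℝ 2 μ →ₗ[ℝ] E.domain :=
  (toDomain E).toLinearMap ∘ₗ (ContinuousLinearMap.adjoint (toLp E)).toLinearMap

theorem form_resolvent_add_inner (f : Lp ℝ 2 μ) (w : E.domain) :
    E.form (E.resolvent f) w + inner ℝ (E.resolvent f : Lp ℝ 2 μ) (w : Lp ℝ 2 μ) =
      inner ℝ f (w : Lp ℝ 2 μ) :=
  ContinuousLinearMap.adjoint_inner_left (toLp E) ((toDomain E).symm w) f

theorem inner_resolvent_left (f g : Lp ℝ 2 μ) :
    inner ℝ (E.resolvent f : Lp ℝ 2 μ) g = inner ℝ f (E.resolvent g : Lp ℝ 2 μ) := by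
  rw [← E.form_resolvent_add_inner f, E.symm, real_inner_comm,
    ← E.form_resolvent_add_inner g, real_inner_comm (E.resolvent f : Lp ℝ 2 μ)]

theorem resolvent_nonneg {f : Lp ℝ 2 μ} (hf : 0 ≤ f) : 0 ≤ (E.resolvent f : Lp ℝ 2 μ) := by
  set u := E.resolvent f with hu
  obtain ⟨w, hw, hle⟩ := E.abs_contraction u
  have hnorm : ‖w‖ = ‖u‖ := (congrArg norm hw).trans (norm_abs_eq_norm _)
  have hform : E.form u u - E.form u w + (‖u‖ ^ 2 - inner ℝ u w) ≤ 0 := by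
    have huu := E.form_resolvent_add_inner f u
    have huw := E.form_resolvent_add_inner f w
    have hinner := inner_lp_nonneg hf (sub_nonneg.2 (le_abs_self (u : Lp ℝ 2 μ)))
    rw [← hw, inner_sub_right, ← huu, ← huw, ← hu] at hinner
    rw [← real_inner_self_eq_norm_sq, Submodule.coe_inner, Submodule.coe_inner]
    linarith
  have hzero : ‖u - w‖ = 0 := by
    have hnonneg := E.nonneg (u - w)
    have hsq := norm_sub_sq_real u w
    rw [form_sub_self] at hnonneg
    rw [hnorm] at hsq
    exact pow_eq_zero_iff two_ne_zero |>.1 (le_antisymm (by linarith) (sq_nonneg _))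
  rw [sub_eq_zero.1 (norm_eq_zero.1 hzero), hw]
  exact abs_nonneg _

end Resolvent

end DirichletForm

theorem rpow_le_rpow_half_of_sq_le {P Q p : ℝ} (hP : 0 ≤ P) (hp : 0 ≤ p) (hPQ : P ^ 2 ≤ Q) :
    P ^ p ≤ Q ^ (p / 2) :=
  calc P ^ p = (P ^ 2) ^ (p / 2) := by
        rw [← Real.rpow_two, ← Real.rpow_mul hP, mul_div_cancel₀ p two_ne_zero]
    _ ≤ Q ^ (p / 2) := Real.rpow_le_rpow (sq_nonneg P) hPQ (by positivity)

namespace DirichletForm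

variable {M : Type*} [MeasurableSpace M] {μ : Measure M} [IsFiniteMeasure μ]

/-- The form domain embeds in `Lᵖ`, with `‖v‖ₚ² ≤ C (𝓔(v) + ‖v‖₂²)`. For `p > 2` this is all that
compactness of the embedding in `L²` requires. -/
def SobolevBound (E : DirichletForm μ) (p C : ℝ) : Prop :=
  ∀ v : E.domain, MemLp (v : Lp ℝ 2 μ) (ENNReal.ofReal p) μ ∧
    (eLpNorm (v : Lp ℝ 2 μ) (ENNReal.ofReal p) μ).toReal ^ 2 ≤ C * (E.form v v + ‖v‖ ^ 2)

section Smoothing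

variable (E : DirichletForm μ)

theorem exists_min_resolvent {f : Lp ℝ 2 μ} (hf : 0 ≤ f) {k : ℝ} (hk : 0 < k) :
    ∃ a : E.domain,
      ((a : Lp ℝ 2 μ) =ᵐ[μ] fun x => min ((E.resolvent f : Lp ℝ 2 μ) x) k) ∧
      E.form a a + ‖a‖ ^ 2 ≤ k * ∫ x, f x ∂μ := by
  set u := E.resolvent f
  have hu0 : 0 ≤ (u : Lp ℝ 2 μ) := E.resolvent_nonneg hf
  obtain ⟨a, ha, -⟩ := E.exists_min_const hu0 hk
  have ha0 : 0 ≤ (a : Lp ℝ 2 μ) := by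
    rw [← Lp.coeFn_nonneg] at hu0 ⊢
    filter_upwards [ha, hu0] with x hax hux
    exact hax ▸ le_min hux hk.le
  have hau : (a : Lp ℝ 2 μ) ≤ (u : Lp ℝ 2 μ) := by
    rw [← Lp.coeFn_le]
    filter_upwards [ha] with x hax
    exact hax ▸ min_le_left _ _
  have hform := E.form_min_const_sub_nonneg hu0 hk ha
  have hinner := inner_lp_nonneg ha0 (sub_nonneg.2 hau)
  have hresolvent := E.form_resolvent_add_inner f a
  rw [map_sub, E.symm a u] at hform
  rw [inner_sub_right, real_inner_comm] at hinner
  refine ⟨a, ha, ?_⟩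
  calc E.form a a + ‖a‖ ^ 2 = E.form a a + inner ℝ (a : Lp ℝ 2 μ) (a : Lp ℝ 2 μ) := by
        rw [← Submodule.coe_inner, real_inner_self_eq_norm_sq]
    _ ≤ inner ℝ f (a : Lp ℝ 2 μ) := by linarith
    _ = ∫ x, f x * (a : Lp ℝ 2 μ) x ∂μ := inner_lp_eq_integral_mul f a
    _ ≤ ∫ x, f x * k ∂μ := by
        refine integral_mono_ae (integrable_lp_mul f a) ((integrable_lp f).mul_const k) ?_
        filter_upwards [ha, (Lp.coeFn_nonneg f).2 hf] with x hax hfx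
        exact mul_le_mul_of_nonneg_left (hax ▸ min_le_right _ _) hfx
    _ = k * ∫ x, f x ∂μ := by rw [integral_mul_const, mul_comm]

variable {E} {p C : ℝ}

theorem SobolevBound.measureReal_resolvent_le (hE : E.SobolevBound p C) (hp : 0 < p) (hC : 0 ≤ C)
    {f : Lp ℝ 2 μ} (hf : 0 ≤ f) {k : ℝ} (hk : 0 < k) :
    μ.real {x | k ≤ (E.resolvent f : Lp ℝ 2 μ) x} ≤
      (C * ∫ x, f x ∂μ) ^ (p / 2) * k ^ (-(p / 2)) := by
  obtain ⟨a, ha, ha_le⟩ := E.exists_min_resolvent hf hk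
  obtain ⟨hap, hsobolev⟩ := hE a
  have hmass : 0 ≤ ∫ x, f x ∂μ := integral_nonneg_of_ae ((Lp.coeFn_nonneg f).2 hf)
  have hmono : μ.real {x | k ≤ (E.resolvent f : Lp ℝ 2 μ) x} ≤
      μ.real {x | k ≤ |(a : Lp ℝ 2 μ) x|} := by
    refine ENNReal.toReal_mono (measure_ne_top _ _) (measure_mono_ae ?_)
    filter_upwards [ha] with x hax hkx
    change k ≤ _ at hkx
    change k ≤ |(a : Lp ℝ 2 μ) x|
    rw [hax, min_eq_right hkx]
    exact le_abs_self k
  set P := (eLpNorm (a : Lp ℝ 2 μ) (ENNReal.ofReal p) μ).toReal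
  have hpow : P ^ p ≤ (C * ∫ x, f x ∂μ) ^ (p / 2) * k ^ (p / 2) :=
    calc P ^ p ≤ ((C * ∫ x, f x ∂μ) * k) ^ (p / 2) := by
          refine rpow_le_rpow_half_of_sq_le ENNReal.toReal_nonneg hp.le (hsobolev.trans ?_)
          calc _ ≤ C * (k * ∫ x, f x ∂μ) := by gcongr
            _ = _ := by ring
      _ = _ := Real.mul_rpow (by positivity) hk.le
  have hkp : 0 < k ^ p := Real.rpow_pos_of_pos hk p
  refine le_of_mul_le_mul_left ?_ hkp
  calc k ^ p * μ.real {x | k ≤ (E.resolvent f : Lp ℝ 2 μ) x}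
      ≤ k ^ p * μ.real {x | k ≤ |(a : Lp ℝ 2 μ) x|} := by gcongr
    _ ≤ P ^ p := rpow_mul_measureReal_le_eLpNorm_rpow hp hap hk
    _ ≤ (C * ∫ x, f x ∂μ) ^ (p / 2) * k ^ (p / 2) := hpow
    _ = k ^ p * ((C * ∫ x, f x ∂μ) ^ (p / 2) * k ^ (-(p / 2))) := by
        rw [mul_left_comm, ← Real.rpow_add hk]
        ring_nf

/-- The weak type bound for the resolvent of `f` is integrated over the levels above a multiple of
the mass of `f`, which makes the estimate homogeneous in `f`. -/
theorem SobolevBound.inner_resolvent_le (hE : E.SobolevBound p C) (hp : 2 < p) (hC : 0 ≤ C)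
    {f g : Lp ℝ 2 μ} (hf : 0 ≤ f) (hg : ∀ᵐ x ∂μ, |g x| ≤ 1) {m K : ℝ} (hm : 0 < m)
    (hfm : ∫ x, f x ∂μ = m) (hK : 0 < K) :
    inner ℝ g (E.resolvent f : Lp ℝ 2 μ) ≤
      m * (K * ∫ x, |g x| ∂μ + C ^ (p / 2) * (K ^ (1 - p / 2) / (p / 2 - 1))) := by
  set u : Lp ℝ 2 μ := (E.resolvent f : Lp ℝ 2 μ)
  have htail : ∫ x, max (u x - K * m) 0 ∂μ ≤
      (C * m) ^ (p / 2) * ((K * m) ^ (1 - p / 2) / (p / 2 - 1)) :=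
    integral_max_sub_le_of_measureReal_le (integrable_lp u) (by linarith) (by positivity)
      fun t ht => hfm ▸ hE.measureReal_resolvent_le (by linarith) hC hf
        ((mul_pos hK hm).trans ht)
  calc inner ℝ g u ≤ K * m * ∫ x, |g x| ∂μ + ∫ x, max (u x - K * m) 0 ∂μ :=
        inner_lp_le_mul_integral_abs_add hg (E.resolvent_nonneg hf) (K * m)
    _ ≤ K * m * ∫ x, |g x| ∂μ + (C * m) ^ (p / 2) * ((K * m) ^ (1 - p / 2) / (p / 2 - 1)) := by
        gcongr
    _ = _ := by
        have hmpow : m ^ (p / 2) * m ^ (1 - p / 2) = m := by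
          rw [← Real.rpow_add hm, add_sub_cancel, Real.rpow_one]
        rw [Real.mul_rpow hC hm.le, Real.mul_rpow hK.le hm.le]
        linear_combination (C ^ (p / 2) * K ^ (1 - p / 2) / (p / 2 - 1)) * hmpow

theorem SobolevBound.ae_resolvent_le (hE : E.SobolevBound p C) (hp : 2 < p) (hC : 0 ≤ C)
    {g : Lp ℝ 2 μ} (hg : ∀ᵐ x ∂μ, |g x| ≤ 1) {η K : ℝ} (hK : 0 < K)
    (hη : K * ∫ x, |g x| ∂μ + C ^ (p / 2) * (K ^ (1 - p / 2) / (p / 2 - 1)) < η) :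
    ∀ᵐ x ∂μ, (E.resolvent g : Lp ℝ 2 μ) x ≤ η := by
  set v : Lp ℝ 2 μ := (E.resolvent g : Lp ℝ 2 μ) with hv
  let S : Set M := {x | η < v x}
  have hS : MeasurableSet S :=
    measurableSet_lt measurable_const (Lp.stronglyMeasurable v).measurable
  let f : Lp ℝ 2 μ := indicatorConstLp 2 hS (measure_ne_top μ S) (1 : ℝ)
  have hf0 : 0 ≤ f := by
    rw [← Lp.coeFn_nonneg]
    filter_upwards [indicatorConstLp_coeFn (p := 2) (hs := hS) (hμs := measure_ne_top μ S)
      (c := (1 : ℝ))] with x hx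
    exact hx ▸ Set.indicator_nonneg (fun _ _ => zero_le_one) x
  have hfm : ∫ x, f x ∂μ = μ.real S := by
    rw [integral_indicatorConstLp, smul_eq_mul, mul_one]
  suffices hnull : μ.real S = 0 by
    have hmeas : μ S = 0 := (measureReal_eq_zero_iff).1 hnull
    simpa only [ae_iff, not_le] using hmeas
  by_contra hne
  have hpos : 0 < μ.real S := lt_of_le_of_ne measureReal_nonneg (Ne.symm hne)
  have hlower : η * μ.real S ≤ inner ℝ g (E.resolvent f : Lp ℝ 2 μ) := by
    rw [← inner_resolvent_left, ← hv, real_inner_comm, L2.inner_indicatorConstLp_one,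
      mul_comm, ← smul_eq_mul, ← setIntegral_const]
    exact setIntegral_mono_on (integrable_const η).integrableOn (integrable_lp v).integrableOn hS
      fun x hx => le_of_lt hx
  have hupper := hE.inner_resolvent_le hp hC hf0 hg hpos hfm hK
  nlinarith

theorem SobolevBound.smoothsBoundedFunctions_resolvent (hE : E.SobolevBound p C) (hp : 2 < p)
    (hC : 0 ≤ C) : SmoothsBoundedFunctions (E.domain.subtype ∘ₗ E.resolvent) := by
  intro η hη
  have htail : Tendsto (fun K : ℝ => C ^ (p / 2) * (K ^ (1 - p / 2) / (p / 2 - 1))) atTop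
      (𝓝 0) := by
    have hrpow := tendsto_rpow_neg_atTop (show 0 < p / 2 - 1 by linarith)
    simpa only [neg_sub, zero_div, mul_zero] using
      (hrpow.div_const (p / 2 - 1)).const_mul (C ^ (p / 2))
  obtain ⟨K, hKη, hK⟩ :=
    ((htail.eventually (gt_mem_nhds (half_pos hη))).and (eventually_gt_atTop 0)).exists
  set c : ℝ := ‖Lp.const 2 μ (1 : ℝ)‖
  have hc0 : 0 ≤ c := norm_nonneg _
  have hone_sided {g : Lp ℝ 2 μ} (hg : ∀ᵐ x ∂μ, |g x| ≤ 1) (hgδ : ‖g‖ ≤ η / (2 * K * (c + 1))) :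
      ∀ᵐ x ∂μ, (E.resolvent g : Lp ℝ 2 μ) x ≤ η := by
    refine hE.ae_resolvent_le hp hC hg hK ?_
    have hsmall : K * ∫ x, |g x| ∂μ ≤ η / 2 :=
      calc K * ∫ x, |g x| ∂μ ≤ K * (η / (2 * K * (c + 1)) * (c + 1)) := by
            gcongr
            refine (integral_abs_le_norm_mul g).trans ?_
            gcongr
            linarith
        _ = η / 2 := by field_simp
    linarith
  refine ⟨η / (2 * K * (c + 1)), by positivity, fun g hg hgδ => ?_⟩
  have hneg : ∀ᵐ x ∂μ, |(-g) x| ≤ 1 := by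
    filter_upwards [hg, Lp.coeFn_neg g] with x hx hn
    rwa [hn, Pi.neg_apply, abs_neg]
  have hneg_le := hone_sided hneg (by rwa [norm_neg])
  rw [map_neg] at hneg_le
  filter_upwards [hone_sided hg hgδ, hneg_le, Lp.coeFn_neg (E.resolvent g : Lp ℝ 2 μ)]
    with x hle hle_neg hn
  rw [Submodule.coe_neg, hn, Pi.neg_apply] at hle_neg
  exact abs_le'.2 ⟨hle, hle_neg⟩

end Smoothing

end DirichletForm

section Truncation

variable {M : Type*} [MeasurableSpace M] {μ : Measure M}

theorem exists_truncation [IsFiniteMeasure μ] (f : Lp ℝ 2 μ) (N : ℝ) :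
    ∃ t : Lp ℝ 2 μ, t =ᵐ[μ] fun x => max (-N) (min (f x) N) := by
  refine ⟨Lp.const 2 μ (-N) ⊔ (f ⊓ Lp.const 2 μ N), ?_⟩
  filter_upwards [Lp.coeFn_sup (Lp.const 2 μ (-N)) (f ⊓ Lp.const 2 μ N),
    Lp.coeFn_inf f (Lp.const 2 μ N), Lp.coeFn_const (p := 2) (μ := μ) N,
    Lp.coeFn_const (p := 2) (μ := μ) (-N)] with x hsup hinf hconst hneg
  rw [hsup, Pi.sup_apply, hinf, Pi.inf_apply, hconst, hneg, Function.const_apply,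
    Function.const_apply]

theorem sq_le_mul_truncation_add {p N : ℝ} (hp : 2 ≤ p) (hN : 0 < N) (s : ℝ) :
    s ^ 2 ≤ s * max (-N) (min s N) + N ^ (2 - p) * |s| ^ p := by
  rcases le_or_gt |s| N with hs | hs
  · rw [min_eq_left (abs_le.1 hs).2, max_eq_right (abs_le.1 hs).1, ← sq]
    exact le_add_of_nonneg_right (by positivity)
  · have htail : s ^ 2 ≤ N ^ (2 - p) * |s| ^ p :=
      calc s ^ 2 = |s| ^ (2 - p) * |s| ^ p := by
            rw [← Real.rpow_add (hN.trans hs), sub_add_cancel, Real.rpow_two, sq_abs]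
        _ ≤ N ^ (2 - p) * |s| ^ p :=
            mul_le_mul_of_nonneg_right
              (Real.rpow_le_rpow_of_nonpos hN hs.le (sub_nonpos.2 hp)) (by positivity)
    refine htail.trans (le_add_of_nonneg_left ?_)
    rcases le_total 0 s with hs0 | hs0
    · exact mul_nonneg hs0 (le_max_of_le_right (le_min hs0 hN.le))
    · rw [abs_of_nonpos hs0] at hs
      rw [max_eq_left ((min_le_left s N).trans (by linarith))]
      nlinarith

theorem integrable_abs_rpow {p : ℝ} (hp : 0 < p) {w : M → ℝ}
    (hw : MemLp w (ENNReal.ofReal p) μ) : Integrable (fun x => |w x| ^ p) μ := by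
  have hint := hw.integrable_norm_rpow (ENNReal.ofReal_pos.2 hp).ne' ENNReal.ofReal_ne_top
  rwa [ENNReal.toReal_ofReal hp.le] at hint

theorem integral_abs_rpow_eq {p : ℝ} (hp : 0 < p) {w : M → ℝ}
    (hw : MemLp w (ENNReal.ofReal p) μ) :
    ∫ x, |w x| ^ p ∂μ = (eLpNorm w (ENNReal.ofReal p) μ).toReal ^ p := by
  have hnonneg : 0 ≤ ∫ x, ‖w x‖ ^ p ∂μ := integral_nonneg fun x => by positivity
  rw [hw.eLpNorm_eq_integral_rpow_norm (ENNReal.ofReal_pos.2 hp).ne' ENNReal.ofReal_ne_top,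
    ENNReal.toReal_ofReal hp.le, ENNReal.toReal_ofReal (by positivity), ← Real.rpow_mul hnonneg,
    inv_mul_cancel₀ hp.ne', Real.rpow_one]
  rfl

theorem norm_sq_le_inner_truncation_add {p N : ℝ} (hp : 2 ≤ p) (hN : 0 < N) {f t : Lp ℝ 2 μ}
    (hf : MemLp f (ENNReal.ofReal p) μ) (ht : t =ᵐ[μ] fun x => max (-N) (min (f x) N)) :
    ‖f‖ ^ 2 ≤ inner ℝ f t +
      N ^ (2 - p) * (eLpNorm f (ENNReal.ofReal p) μ).toReal ^ p := by
  have hint := integrable_abs_rpow (by linarith) hf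
  rw [← integral_abs_rpow_eq (by linarith) hf, norm_lp_sq_eq_integral_sq,
    inner_lp_eq_integral_mul, ← integral_const_mul,
    ← integral_add (integrable_lp_mul f t) (hint.const_mul _)]
  refine integral_mono_ae (Lp.memLp f).integrable_sq
    ((integrable_lp_mul f t).add (hint.const_mul _)) ?_
  filter_upwards [ht] with x htx
  rw [htx]
  exact sq_le_mul_truncation_add hp hN (f x)

end Truncation

namespace DirichletForm

open FormSpace

variable {M : Type*} [MeasurableSpace M] {μ : Measure M} [IsFiniteMeasure μ]

section CompactEmbedding

variable {E : DirichletForm μ}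

theorem tendsto_adjoint_toLp_of_tendstoWeakly
    (hT : SmoothsBoundedFunctions (E.domain.subtype ∘ₗ E.resolvent)) {z : ℕ → Lp ℝ 2 μ}
    (hz : TendstoWeakly z 0) {N : ℝ} (hN : 0 < N) (hzN : ∀ n, ∀ᵐ x ∂μ, |z n x| ≤ N) :
    Tendsto (fun n => ContinuousLinearMap.adjoint (toLp E) (z n)) atTop (𝓝 0) := by
  have hsq (n : ℕ) : ‖ContinuousLinearMap.adjoint (toLp E) (z n)‖ ^ 2 ≤
      N * ∫ x, |(E.resolvent (z n) : Lp ℝ 2 μ) x| ∂μ := by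
    rw [← real_inner_self_eq_norm_sq, ContinuousLinearMap.adjoint_inner_left,
      inner_lp_eq_integral_mul, ← integral_const_mul]
    change ∫ x, z n x * (E.resolvent (z n) : Lp ℝ 2 μ) x ∂μ ≤ _
    refine integral_mono_ae (integrable_lp_mul _ _) ((integrable_lp _).abs.const_mul N) ?_
    filter_upwards [hzN n] with x hx
    exact (le_abs_self _).trans ((abs_mul _ _).trans_le (by gcongr))
  have hlim := (hT.tendsto_integral_abs hz hN hzN).const_mul N
  rw [mul_zero] at hlim
  have hnorm := (squeeze_zero (fun n => sq_nonneg _) hsq hlim).sqrt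
  simp only [Real.sqrt_sq (norm_nonneg _), Real.sqrt_zero] at hnorm
  exact tendsto_zero_iff_norm_tendsto_zero.2 hnorm

theorem tendsto_inner_toLp_of_bounded
    (hT : SmoothsBoundedFunctions (E.domain.subtype ∘ₗ E.resolvent)) {w : ℕ → FormSpace E}
    (hw : TendstoWeakly w 0) {R : ℝ} (hR : ∀ n, ‖w n‖ ≤ R) {t : ℕ → Lp ℝ 2 μ} {N : ℝ}
    (hN : 0 < N) (htN : ∀ n, ∀ᵐ x ∂μ, |t n x| ≤ N) :
    Tendsto (fun n => inner ℝ (toLp E (w n)) (t n)) atTop (𝓝 0) := by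
  refine tendsto_of_subseq_tendsto fun ns hns => ?_
  obtain ⟨s, φ, hφ, hs⟩ := exists_subseq_tendstoWeakly (u := t ∘ ns)
    fun n => Lp.norm_le_of_ae_bound hN.le (htN (ns n))
  have hsN := ae_abs_le_of_tendstoWeakly hs fun n => htN (ns (φ n))
  have hz_bound (n : ℕ) : ∀ᵐ x ∂μ, |(t (ns (φ n)) - s) x| ≤ N + N := by
    filter_upwards [htN (ns (φ n)), hsN, Lp.coeFn_sub (t (ns (φ n))) s] with x htx hsx hsub
    rw [hsub, Pi.sub_apply]
    exact (abs_sub _ _).trans (add_le_add htx hsx)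
  have hz := tendsto_adjoint_toLp_of_tendstoWeakly hT hs.sub_limit (add_pos hN hN) hz_bound
  have hwφ := hw.comp (hns.comp hφ.tendsto_atTop)
  have hfixed := hwφ.inner_tendsto_zero (ContinuousLinearMap.adjoint (toLp E) s)
  have hvary : Tendsto (fun n => inner ℝ (w (ns (φ n)))
      (ContinuousLinearMap.adjoint (toLp E) (t (ns (φ n)) - s))) atTop (𝓝 0) := by
    have hzR := hz.norm.const_mul R
    rw [norm_zero, mul_zero] at hzR
    refine squeeze_zero_norm (fun n => ?_) hzR
    exact (norm_inner_le_norm _ _).trans (mul_le_mul_of_nonneg_right (hR _) (norm_nonneg _))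
  refine ⟨φ, ?_⟩
  simpa only [Function.comp_apply, ← inner_add_right, ← map_add, sub_add_cancel,
    ContinuousLinearMap.adjoint_inner_right, add_zero] using hvary.add hfixed

variable {p C : ℝ}

theorem SobolevBound.eLpNorm_rpow_le (hE : E.SobolevBound p C) (hp : 0 ≤ p) (w : FormSpace E) :
    (eLpNorm (toLp E w) (ENNReal.ofReal p) μ).toReal ^ p ≤ (C * ‖w‖ ^ 2) ^ (p / 2) := by
  rw [norm_sq]
  exact rpow_le_rpow_half_of_sq_le ENNReal.toReal_nonneg hp (hE (toDomain E w)).2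

theorem SobolevBound.tendsto_norm_toLp_zero (hE : E.SobolevBound p C) (hp : 2 < p) (hC : 0 ≤ C)
    {w : ℕ → FormSpace E} (hw : TendstoWeakly w 0) {R : ℝ} (hR : ∀ n, ‖w n‖ ≤ R) :
    Tendsto (fun n => ‖toLp E (w n)‖) atTop (𝓝 0) := by
  have hT := hE.smoothsBoundedFunctions_resolvent hp hC
  choose t ht using fun (N : ℝ) (n : ℕ) => exists_truncation (toLp E (w n)) N
  have hinner {N : ℝ} (hN : 0 < N) :
      Tendsto (fun n => inner ℝ (toLp E (w n)) (t N n)) atTop (𝓝 0) := by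
    refine tendsto_inner_toLp_of_bounded hT hw hR hN fun n => ?_
    filter_upwards [ht N n] with x hx
    rw [hx]
    exact abs_le.2 ⟨le_max_left _ _, max_le (by linarith) (min_le_right _ _)⟩
  have hsq {N : ℝ} (hN : 0 < N) (n : ℕ) : ‖toLp E (w n)‖ ^ 2 ≤
      inner ℝ (toLp E (w n)) (t N n) + N ^ (2 - p) * (C * R ^ 2) ^ (p / 2) := by
    refine (norm_sq_le_inner_truncation_add (f := toLp E (w n)) hp.le hN
      (hE (toDomain E (w n))).1 (ht N n)).trans ?_
    gcongr
    refine (hE.eLpNorm_rpow_le (by linarith) (w n)).trans ?_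
    gcongr
    exact hR n
  have htail : Tendsto (fun N : ℝ => N ^ (2 - p) * (C * R ^ 2) ^ (p / 2)) atTop (𝓝 0) := by
    simpa only [neg_sub, zero_mul] using
      (tendsto_rpow_neg_atTop (sub_pos.2 hp)).mul_const ((C * R ^ 2) ^ (p / 2))
  have hlim : Tendsto (fun n => ‖toLp E (w n)‖ ^ 2) atTop (𝓝 0) := by
    refine tendsto_order.2 ⟨fun a ha => .of_forall fun n => ha.trans_le (sq_nonneg _),
      fun ε hε => ?_⟩
    obtain ⟨N, hNε, hN⟩ :=
      ((htail.eventually (gt_mem_nhds (half_pos hε))).and (eventually_gt_atTop 0)).exists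
    filter_upwards [(hinner hN).eventually (gt_mem_nhds (half_pos hε))] with n hn
    linarith [hsq hN n]
  simpa only [Real.sqrt_sq (norm_nonneg _), Real.sqrt_zero] using hlim.sqrt

end CompactEmbedding

end DirichletForm

section BrezisLieb

variable {M : Type*} [MeasurableSpace M] {μ : Measure M}

theorem integrable_and_integral_le_of_tendsto {f : ℕ → M → ℝ} {g : M → ℝ} {b : ℕ → ℝ} {c : ℝ}
    (hf : ∀ n, Integrable (f n) μ) (hf0 : ∀ n, ∀ᵐ x ∂μ, 0 ≤ f n x)
    (hg : ∀ᵐ x ∂μ, Tendsto (fun n => f n x) atTop (𝓝 (g x)))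
    (hb : ∀ n, ∫ x, f n x ∂μ ≤ b n) (hc : Tendsto b atTop (𝓝 c)) :
    Integrable g μ ∧ ∫ x, g x ∂μ ≤ c := by
  have hgm : AEStronglyMeasurable g μ :=
    aestronglyMeasurable_of_tendsto_ae atTop (fun n => (hf n).1) hg
  have hg0 : 0 ≤ᵐ[μ] g := by
    filter_upwards [hg, ae_all_iff.2 hf0] with x hx hx0
    exact ge_of_tendsto' hx hx0
  have hc0 : 0 ≤ c := ge_of_tendsto' hc fun n => (integral_nonneg_of_ae (hf0 n)).trans (hb n)
  have hfatou : ∫⁻ x, ENNReal.ofReal (g x) ∂μ ≤ ENNReal.ofReal c :=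
    calc ∫⁻ x, ENNReal.ofReal (g x) ∂μ
        = ∫⁻ x, liminf (fun n => ENNReal.ofReal (f n x)) atTop ∂μ := lintegral_congr_ae (by
          filter_upwards [hg] with x hx using (ENNReal.tendsto_ofReal hx).liminf_eq.symm)
      _ ≤ liminf (fun n => ∫⁻ x, ENNReal.ofReal (f n x) ∂μ) atTop :=
        lintegral_liminf_le' fun n => (hf n).1.aemeasurable.ennreal_ofReal
      _ ≤ liminf (fun n => ENNReal.ofReal (b n)) atTop :=
        liminf_le_liminf (.of_forall fun n => by
          rw [← ofReal_integral_eq_lintegral_ofReal (hf n) (hf0 n)]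
          exact ENNReal.ofReal_le_ofReal (hb n))
      _ = ENNReal.ofReal c := (ENNReal.tendsto_ofReal hc).liminf_eq
  refine ⟨⟨hgm, ?_⟩, ?_⟩
  · rw [hasFiniteIntegral_iff_ofReal hg0]
    exact hfatou.trans_lt ENNReal.ofReal_lt_top
  · rw [integral_eq_lintegral_of_nonneg_ae hg0 hgm]
    exact ENNReal.toReal_le_of_le_ofReal hc0 hfatou

theorem abs_add_rpow_le {p τ : ℝ} (hp : 1 ≤ p) (hτ0 : 0 < τ) (hτ1 : τ < 1) (s t : ℝ) :
    |s + t| ^ p ≤ (1 - τ) ^ (1 - p) * |s| ^ p + τ ^ (1 - p) * |t| ^ p := by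
  have h1τ : 0 < 1 - τ := sub_pos.2 hτ1
  have hweight {a : ℝ} (ha : 0 < a) {b : ℝ} (hb : 0 ≤ b) :
      a * (b / a) ^ p = a ^ (1 - p) * b ^ p := by
    rw [Real.div_rpow hb ha.le, Real.rpow_sub ha, Real.rpow_one]
    ring
  have hconvex := (convexOn_rpow hp).2 (x := |s| / (1 - τ)) (y := |t| / τ)
    (Set.mem_Ici.2 (by positivity)) (Set.mem_Ici.2 (by positivity)) h1τ.le hτ0.le
    (sub_add_cancel 1 τ)
  simp only [smul_eq_mul, mul_div_cancel₀ _ h1τ.ne', mul_div_cancel₀ _ hτ0.ne',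
    hweight h1τ (abs_nonneg s), hweight hτ0 (abs_nonneg t)] at hconvex
  exact (Real.rpow_le_rpow (abs_nonneg _) (abs_add_le s t) (by linarith)).trans hconvex

variable {p c : ℝ} {u : ℕ → M → ℝ} {v : M → ℝ} {b : ℕ → ℝ}

theorem le_integral_abs_rpow_add_rpow_mul {a τ : ℝ} (hp : 1 ≤ p) (hτ0 : 0 < τ) (hτ1 : τ < 1)
    (hu : ∀ n, Integrable (fun x => |u n x| ^ p) μ) (hv : Integrable (fun x => |v x| ^ p) μ)
    (huv : ∀ n, Integrable (fun x => |u n x - v x| ^ p) μ)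
    (ha : Tendsto (fun n => ∫ x, |u n x| ^ p ∂μ) atTop (𝓝 a))
    (hb : ∀ n, ∫ x, |u n x - v x| ^ p ∂μ ≤ b n) (hc : Tendsto b atTop (𝓝 c))
    (hlim : ∀ᵐ x ∂μ, Tendsto (fun n => u n x) atTop (𝓝 (v x))) :
    a ≤ ∫ x, |v x| ^ p ∂μ + τ ^ (1 - p) * c := by
  set K := (1 - τ) ^ (1 - p)
  have hupper (n : ℕ) : Integrable (fun x => K * |v x| ^ p + τ ^ (1 - p) * |u n x - v x| ^ p) μ :=
    (hv.const_mul _).add ((huv n).const_mul _)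
  have hfatou := (integrable_and_integral_le_of_tendsto
    (f := fun n x => K * |v x| ^ p + τ ^ (1 - p) * |u n x - v x| ^ p - |u n x| ^ p)
    (g := fun x => K * |v x| ^ p - |v x| ^ p)
    (b := fun n => K * ∫ x, |v x| ^ p ∂μ + τ ^ (1 - p) * b n - ∫ x, |u n x| ^ p ∂μ)
    (fun n => (hupper n).sub (hu n)) (fun n => .of_forall fun x => ?_) ?_ (fun n => ?_)
    (((hc.const_mul _).const_add _).sub ha)).2
  · rw [integral_sub (hv.const_mul _) hv, integral_const_mul] at hfatou
    linarith
  · have hconvex := abs_add_rpow_le hp hτ0 hτ1 (v x) (u n x - v x)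
    rw [add_sub_cancel] at hconvex
    exact sub_nonneg.2 hconvex
  · filter_upwards [hlim] with x hx
    have hp0 : 0 < p := by linarith
    have hsub := ((hx.sub_const (v x)).abs.rpow_const (p := p) (.inr hp0.le)).const_mul
      (τ ^ (1 - p))
    rw [sub_self, abs_zero, Real.zero_rpow hp0.ne', mul_zero] at hsub
    simpa only [add_zero] using
      (hsub.const_add (K * |v x| ^ p)).sub (hx.abs.rpow_const (p := p) (.inr hp0.le))
  · rw [integral_sub (hupper n) (hu n),
      integral_add (hv.const_mul _) ((huv n).const_mul _), integral_const_mul, integral_const_mul]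
    gcongr
    exact hb n

/-- One half of the Brezis–Lieb lemma. -/
theorem le_integral_abs_rpow_add {a : ℝ} (hp : 1 ≤ p)
    (hu : ∀ n, Integrable (fun x => |u n x| ^ p) μ) (hv : Integrable (fun x => |v x| ^ p) μ)
    (huv : ∀ n, Integrable (fun x => |u n x - v x| ^ p) μ)
    (ha : Tendsto (fun n => ∫ x, |u n x| ^ p ∂μ) atTop (𝓝 a))
    (hb : ∀ n, ∫ x, |u n x - v x| ^ p ∂μ ≤ b n) (hc : Tendsto b atTop (𝓝 c))
    (hlim : ∀ᵐ x ∂μ, Tendsto (fun n => u n x) atTop (𝓝 (v x))) :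
    a ≤ ∫ x, |v x| ^ p ∂μ + c := by
  have hweight : Tendsto (fun τ : ℝ => ∫ x, |v x| ^ p ∂μ + τ ^ (1 - p) * c) (𝓝[<] 1)
      (𝓝 (∫ x, |v x| ^ p ∂μ + 1 ^ (1 - p) * c)) :=
    (((Real.continuousAt_rpow_const 1 (1 - p) (.inl one_ne_zero)).tendsto.mul_const c).const_add
      _).mono_left nhdsWithin_le_nhds
  rw [Real.one_rpow, one_mul] at hweight
  refine ge_of_tendsto hweight ?_
  filter_upwards [Ioo_mem_nhdsLT zero_lt_one] with τ hτ
  exact le_integral_abs_rpow_add_rpow_mul hp hτ.1 hτ.2 hu hv huv ha hb hc hlim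

end BrezisLieb

theorem eq_one_of_concentration {a e y A s : ℝ} (ha0 : 0 ≤ a) (ha1 : a ≤ 1) (hA : 0 < A)
    (hy : y < 1 / A) (hs0 : 0 ≤ s) (hs1 : s ≤ 1) (henergy : y * a ^ s + e ≤ y)
    (hmass : (1 - a) ^ s ≤ A * e) : a = 1 := by
  by_contra hne
  have hlost : 0 < 1 - a := sub_pos.2 (lt_of_le_of_ne ha1 hne)
  have he : 0 < e := pos_of_mul_pos_right ((Real.rpow_pos_of_pos hlost s).trans_le hmass) hA.le
  have hsplit : 1 - a ^ s ≤ (1 - a) ^ s := by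
    linarith [Real.self_le_rpow_of_le_one ha0 ha1 hs1,
      Real.self_le_rpow_of_le_one hlost.le (sub_le_self 1 ha0) hs1]
  rcases le_total y 0 with hy0 | hy0
  · nlinarith [Real.rpow_le_one ha0 ha1 hs0]
  · rw [lt_div_iff₀ hA] at hy
    have hstrict : e < e :=
      calc e ≤ y * (1 - a ^ s) := by linarith
        _ ≤ y * (1 - a) ^ s := by gcongr
        _ ≤ y * (A * e) := by gcongr
        _ = y * A * e := by ring
        _ < 1 * e := by gcongr
        _ = e := one_mul e
    exact hstrict.false

namespace DirichletForm

open FormSpace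

variable {M : Type*} [MeasurableSpace M] {μ : Measure M} [IsFiniteMeasure μ] {E : DirichletForm μ}

/-- Convergence in `L²` and almost everywhere of a sequence in the form domain, along which the
energies converge but an amount `e` of energy, carried by the differences `u n - v`, is lost. -/
structure ConvergesWithDefect (E : DirichletForm μ) (u : ℕ → E.domain) (v : E.domain) (e : ℝ) :
    Prop where
  tendsto_energy : Tendsto (fun n => E.energy (u n)) atTop (𝓝 (E.energy v + e))
  tendsto_energy_sub : Tendsto (fun n => E.energy (u n - v)) atTop (𝓝 e)
  tendsto_norm_sub : Tendsto (fun n => ‖u n - v‖) atTop (𝓝 0)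
  tendsto_ae : ∀ᵐ x ∂μ, Tendsto (fun n => (u n : Lp ℝ 2 μ) x) atTop (𝓝 ((v : Lp ℝ 2 μ) x))

theorem ConvergesWithDefect.defect_nonneg {u : ℕ → E.domain} {v : E.domain} {e : ℝ}
    (h : ConvergesWithDefect E u v e) : 0 ≤ e :=
  ge_of_tendsto' h.tendsto_energy_sub fun n => E.nonneg (u n - v)

section Subsequence

theorem energy_toDomain (w : FormSpace E) :
    E.energy (toDomain E w) = ‖w‖ ^ 2 - ‖toLp E w‖ ^ 2 := by
  rw [norm_sq]
  exact (add_sub_cancel_right _ _).symm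

theorem convergesWithDefect_of_tendstoWeakly {u : ℕ → FormSpace E} {v : FormSpace E} {l : ℝ}
    (hu : TendstoWeakly u v) (hl : Tendsto (fun n => ‖u n‖ ^ 2) atTop (𝓝 l))
    (hLp : Tendsto (fun n => toLp E (u n)) atTop (𝓝 (toLp E v)))
    (hae : ∀ᵐ x ∂μ, Tendsto (fun n => toLp E (u n) x) atTop (𝓝 (toLp E v x))) :
    ConvergesWithDefect E (fun n => toDomain E (u n)) (toDomain E v) (l - ‖v‖ ^ 2) where
  tendsto_energy := by
    have hlim := hl.sub (hLp.norm.pow 2)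
    rw [show l - ‖toLp E v‖ ^ 2 = ‖v‖ ^ 2 - ‖toLp E v‖ ^ 2 + (l - ‖v‖ ^ 2) by ring] at hlim
    simpa only [energy_toDomain] using hlim
  tendsto_energy_sub := by
    have hsub : Tendsto (fun n => ‖toLp E (u n) - toLp E v‖ ^ 2) atTop (𝓝 0) := by
      simpa only [zero_pow two_ne_zero] using (tendsto_iff_norm_sub_tendsto_zero.1 hLp).pow 2
    simpa only [← map_sub, energy_toDomain, sub_zero] using (hu.tendsto_norm_sub_sq hl).sub hsub
  tendsto_norm_sub := (tendsto_iff_norm_sub_tendsto_zero.1 hLp :)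
  tendsto_ae := hae

variable {p C : ℝ}

theorem SobolevBound.tendsto_toLp_of_tendstoWeakly (hE : E.SobolevBound p C) (hp : 2 < p)
    (hC : 0 ≤ C) {u : ℕ → FormSpace E} {v : FormSpace E} (hu : TendstoWeakly u v) {R : ℝ}
    (hR : ∀ n, ‖u n‖ ≤ R) : Tendsto (fun n => toLp E (u n)) atTop (𝓝 (toLp E v)) := by
  have hzero := hE.tendsto_norm_toLp_zero hp hC hu.sub_limit (R := R + ‖v‖)
    fun n => (norm_sub_le _ _).trans (by gcongr; exact hR n)
  simp only [map_sub] at hzero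
  exact tendsto_iff_norm_sub_tendsto_zero.2 hzero

theorem SobolevBound.exists_subseq_convergesWithDefect (hE : E.SobolevBound p C) (hp : 2 < p)
    (hC : 0 ≤ C) {u : ℕ → FormSpace E} {R : ℝ} (hR : ∀ n, ‖u n‖ ≤ R) :
    ∃ (v : E.domain) (φ : ℕ → ℕ) (e : ℝ), StrictMono φ ∧
      ConvergesWithDefect E (fun n => toDomain E (u (φ n))) v e := by
  obtain ⟨v, φ, hφ, hweak⟩ := exists_subseq_tendstoWeakly hR
  obtain ⟨l, -, ψ, hψ, hl⟩ := (isCompact_Icc (a := (0 : ℝ)) (b := R ^ 2)).tendsto_subseq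
    (x := fun n => ‖u (φ n)‖ ^ 2)
    fun n => ⟨sq_nonneg _, pow_le_pow_left₀ (norm_nonneg _) (hR (φ n)) 2⟩
  have hLp := hE.tendsto_toLp_of_tendstoWeakly hp hC (hweak.comp hψ.tendsto_atTop)
    fun n => hR (φ (ψ n))
  obtain ⟨χ, hχ, hae⟩ := (tendstoInMeasure_of_tendsto_Lp hLp).exists_seq_tendsto_ae
  exact ⟨toDomain E v, φ ∘ ψ ∘ χ, l - ‖v‖ ^ 2, hφ.comp (hψ.comp hχ),
    convergesWithDefect_of_tendstoWeakly
      ((hweak.comp hψ.tendsto_atTop).comp hχ.tendsto_atTop) (hl.comp hχ.tendsto_atTop)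
      (hLp.comp hχ.tendsto_atTop) hae⟩

end Subsequence

section LowerSemicontinuity

variable {V W : M → ℝ}

theorem InfinitesimallyFormBounded.integrable (hW : E.InfinitesimallyFormBounded W)
    (v : E.domain) : Integrable (fun x => W x * (v : Lp ℝ 2 μ) x ^ 2) μ :=
  ((hW 1 one_pos).choose_spec v).1

theorem InfinitesimallyFormBounded.integral_mul_sq_le (hW : E.InfinitesimallyFormBounded W)
    (hW0 : ∀ x, 0 ≤ W x) (u v : E.domain) {δ : ℝ} (hδ : 0 < δ) :
    ∫ x, W x * (u : Lp ℝ 2 μ) x ^ 2 ∂μ ≤ (1 + δ) * ∫ x, W x * (v : Lp ℝ 2 μ) x ^ 2 ∂μ +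
      (1 + δ⁻¹) * ∫ x, W x * ((u - v : E.domain) : Lp ℝ 2 μ) x ^ 2 ∂μ := by
  have hyoung (a b : ℝ) : a ^ 2 ≤ (1 + δ) * b ^ 2 + (1 + δ⁻¹) * (a - b) ^ 2 := by
    have hsq : (1 + δ) * b ^ 2 + (1 + δ⁻¹) * (a - b) ^ 2 - a ^ 2 =
        δ⁻¹ * (δ * b - (a - b)) ^ 2 := by
      field_simp
      ring
    exact sub_nonneg.1 (hsq ▸ by positivity)
  rw [← integral_const_mul, ← integral_const_mul,
    ← integral_add ((hW.integrable v).const_mul _) ((hW.integrable (u - v)).const_mul _)]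
  refine integral_mono_ae (hW.integrable u)
    (((hW.integrable v).const_mul _).add ((hW.integrable (u - v)).const_mul _)) ?_
  filter_upwards [E.coeFn_domain_sub u v] with x hx
  rw [hx]
  calc _ ≤ W x * _ := mul_le_mul_of_nonneg_left (hyoung _ ((v : Lp ℝ 2 μ) x)) (hW0 x)
    _ = _ := by ring

variable {u : ℕ → E.domain} {v : E.domain} {e y : ℝ}

theorem ConvergesWithDefect.tendsto_integral_mul_sub_sq (h : ConvergesWithDefect E u v e)
    (hW : E.InfinitesimallyFormBounded W) (hW0 : ∀ x, 0 ≤ W x) :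
    Tendsto (fun n => ∫ x, W x * ((u n - v : E.domain) : Lp ℝ 2 μ) x ^ 2 ∂μ) atTop (𝓝 0) := by
  have he := h.defect_nonneg
  refine tendsto_order.2 ⟨fun a ha => .of_forall fun n => ha.trans_le
    (integral_nonneg fun x => mul_nonneg (hW0 x) (sq_nonneg _)), fun η hη => ?_⟩
  obtain ⟨c, hc⟩ := hW (η / (e + 1)) (by positivity)
  have hbound := (h.tendsto_energy_sub.const_mul (η / (e + 1))).add
    ((h.tendsto_norm_sub.pow 2).const_mul c)
  have hlt : η / (e + 1) * e + c * 0 ^ 2 < η := by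
    rw [zero_pow two_ne_zero, mul_zero, add_zero, div_mul_eq_mul_div, div_lt_iff₀ (by positivity)]
    linarith
  filter_upwards [hbound.eventually (gt_mem_nhds hlt)] with n hn
  exact (hc (u n - v)).2.trans_lt hn

theorem ConvergesWithDefect.integral_add_mul_sq_le (h : ConvergesWithDefect E u v e)
    (hW : E.InfinitesimallyFormBounded W) (hW0 : ∀ x, 0 ≤ W x) (hVW : ∀ x, 0 ≤ V x + W x)
    (hu : ∀ n, u n ∈ E.schrodingerDomain V)
    (hy : Tendsto (fun n => E.schrodingerEnergy V (u n)) atTop (𝓝 y)) {δ : ℝ} (hδ : 0 < δ) :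
    Integrable (fun x => (V x + W x) * (v : Lp ℝ 2 μ) x ^ 2) μ ∧
      ∫ x, (V x + W x) * (v : Lp ℝ 2 μ) x ^ 2 ∂μ ≤
        y - (E.energy v + e) + (1 + δ) * ∫ x, W x * (v : Lp ℝ 2 μ) x ^ 2 ∂μ := by
  have hlim := ((hy.sub h.tendsto_energy).add_const
    ((1 + δ) * ∫ x, W x * (v : Lp ℝ 2 μ) x ^ 2 ∂μ)).add
      ((h.tendsto_integral_mul_sub_sq hW hW0).const_mul (1 + δ⁻¹))
  rw [mul_zero, add_zero] at hlim
  refine integrable_and_integral_le_of_tendsto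
    (f := fun n x => (V x + W x) * (u n : Lp ℝ 2 μ) x ^ 2) (fun n => ?_)
    (fun n => .of_forall fun x => mul_nonneg (hVW x) (sq_nonneg _)) ?_ (fun n => ?_) hlim
  · simp only [add_mul]
    exact Integrable.add (hu n) (hW.integrable (u n))
  · filter_upwards [h.tendsto_ae] with x hx
    exact (hx.pow 2).const_mul _
  · simp only [add_mul _ _ (_ ^ 2)]
    rw [integral_add (hu n) (hW.integrable (u n)), schrodingerEnergy]
    linarith [hW.integral_mul_sq_le hW0 (u n) v hδ]

theorem ConvergesWithDefect.schrodingerEnergy_add_le (h : ConvergesWithDefect E u v e)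
    (hW : E.InfinitesimallyFormBounded W) (hW0 : ∀ x, 0 ≤ W x) (hVW : ∀ x, 0 ≤ V x + W x)
    (hu : ∀ n, u n ∈ E.schrodingerDomain V)
    (hy : Tendsto (fun n => E.schrodingerEnergy V (u n)) atTop (𝓝 y)) :
    v ∈ E.schrodingerDomain V ∧ E.schrodingerEnergy V v + e ≤ y := by
  have hv : v ∈ E.schrodingerDomain V := by
    have hint := (h.integral_add_mul_sq_le hW hW0 hVW hu hy one_pos).1.sub (hW.integrable v)
    refine hint.congr (.of_forall fun x => ?_)
    simp only [Pi.sub_apply, add_mul, add_sub_cancel_right]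
  have hlim : Tendsto (fun δ : ℝ => y - (E.energy v + e) +
      (1 + δ) * ∫ x, W x * (v : Lp ℝ 2 μ) x ^ 2 ∂μ) (𝓝[>] 0)
      (𝓝 (y - (E.energy v + e) + (1 + 0) * ∫ x, W x * (v : Lp ℝ 2 μ) x ^ 2 ∂μ)) :=
    (Continuous.tendsto (by fun_prop) 0).mono_left nhdsWithin_le_nhds
  have hle := ge_of_tendsto hlim <| eventually_mem_nhdsWithin.mono fun δ hδ =>
    (h.integral_add_mul_sq_le hW hW0 hVW hu hy hδ).2
  simp only [add_mul _ _ (_ ^ 2)] at hle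
  rw [integral_add hv (hW.integrable v)] at hle
  refine ⟨hv, ?_⟩
  rw [schrodingerEnergy]
  linarith

theorem InfinitesimallyFormBounded.exists_energy_le (hW : E.InfinitesimallyFormBounded W)
    (hVW : ∀ x, 0 ≤ V x + W x) :
    ∃ c : ℝ, 0 ≤ c ∧ ∀ v ∈ E.schrodingerDomain V,
      E.energy v ≤ 2 * E.schrodingerEnergy V v + c * ‖v‖ ^ 2 := by
  obtain ⟨c, hc⟩ := hW (1 / 2) one_half_pos
  refine ⟨2 * |c|, by positivity, fun v hv => ?_⟩
  have hnonneg : 0 ≤ ∫ x, V x * (v : Lp ℝ 2 μ) x ^ 2 ∂μ + ∫ x, W x * (v : Lp ℝ 2 μ) x ^ 2 ∂μ := by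
    rw [← integral_add hv (hW.integrable v)]
    refine integral_nonneg fun x => ?_
    simpa only [Pi.zero_apply, add_mul] using mul_nonneg (hVW x) (sq_nonneg ((v : Lp ℝ 2 μ) x))
  have hcabs : c * ‖v‖ ^ 2 ≤ |c| * ‖v‖ ^ 2 := by
    gcongr
    exact le_abs_self c
  rw [schrodingerEnergy]
  linarith [(hc v).2]

end LowerSemicontinuity

section Scaling

variable {V : M → ℝ} {ν : ℝ}

theorem two_lt_two_mul_div_sub_two (hν : 2 < ν) : 2 < 2 * ν / (ν - 2) := by
  rw [lt_div_iff₀ (by linarith)]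
  linarith

theorem coe_le_yamabeInvariant_iff {y : ℝ} :
    (y : EReal) ≤ E.yamabeInvariant ν V ↔ ∀ v ∈ E.schrodingerDomain V,
      eLpNorm (v : Lp ℝ 2 μ) (sobolevExponent ν) μ = 1 → y ≤ E.schrodingerEnergy V v := by
  simp only [yamabeInvariant, le_iInf_iff, Set.mem_ofPred_eq, and_imp, EReal.coe_le_coe_iff]

theorem mul_smul_sq_ae_eq (V : M → ℝ) (c : ℝ) (v : E.domain) :
    (fun x => V x * ((c • v : E.domain) : Lp ℝ 2 μ) x ^ 2) =ᵐ[μ]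
      fun x => c ^ 2 * (V x * (v : Lp ℝ 2 μ) x ^ 2) := by
  filter_upwards [E.coeFn_domain_smul c v] with x hx
  rw [hx]
  ring

theorem smul_mem_schrodingerDomain {v : E.domain} (hv : v ∈ E.schrodingerDomain V) (c : ℝ) :
    c • v ∈ E.schrodingerDomain V :=
  (Integrable.const_mul hv (c ^ 2)).congr (mul_smul_sq_ae_eq V c v).symm

theorem schrodingerEnergy_smul (c : ℝ) (v : E.domain) :
    E.schrodingerEnergy V (c • v) = c ^ 2 * E.schrodingerEnergy V v := by
  rw [schrodingerEnergy, schrodingerEnergy, energy, energy, form_smul_self,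
    integral_congr_ae (mul_smul_sq_ae_eq V c v), integral_const_mul, mul_add]

theorem mul_eLpNorm_sq_le_schrodingerEnergy {y : ℝ} (hν : 2 < ν)
    (hy : (y : EReal) ≤ E.yamabeInvariant ν V) {v : E.domain} (hv : v ∈ E.schrodingerDomain V)
    (hvp : MemLp (v : Lp ℝ 2 μ) (sobolevExponent ν) μ) :
    y * (eLpNorm (v : Lp ℝ 2 μ) (sobolevExponent ν) μ).toReal ^ 2 ≤ E.schrodingerEnergy V v := by
  generalize hP : (eLpNorm (v : Lp ℝ 2 μ) (sobolevExponent ν) μ).toReal = P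
  rcases (hP ▸ ENNReal.toReal_nonneg : 0 ≤ P).eq_or_lt with hP0 | hP0
  · have hnorm : eLpNorm (v : Lp ℝ 2 μ) (sobolevExponent ν) μ = 0 :=
      ((ENNReal.toReal_eq_zero_iff _).1 (hP.trans hP0.symm)).resolve_right hvp.2.ne
    have hexponent : sobolevExponent ν ≠ 0 :=
      (ENNReal.ofReal_pos.2 (two_pos.trans (two_lt_two_mul_div_sub_two hν))).ne'
    have hv0 : v = 0 :=
      Subtype.ext (Lp.eq_zero_iff_ae_eq_zero.2 ((eLpNorm_eq_zero_iff hvp.1 hexponent).1 hnorm))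
    rw [hv0, ← zero_smul ℝ (0 : E.domain), schrodingerEnergy_smul, ← hP0, zero_pow two_ne_zero,
      mul_zero, zero_mul]
  · have hunit : eLpNorm ((P⁻¹ • v : E.domain) : Lp ℝ 2 μ) (sobolevExponent ν) μ = 1 := by
      rw [Submodule.coe_smul, eLpNorm_congr_ae (Lp.coeFn_smul _ _), eLpNorm_const_smul,
        ← ENNReal.toReal_eq_one_iff, ENNReal.toReal_mul, hP, toReal_enorm,
        Real.norm_of_nonneg (inv_nonneg.2 hP0.le), inv_mul_cancel₀ hP0.ne']
    have hle := coe_le_yamabeInvariant_iff.1 hy _ (smul_mem_schrodingerDomain hv P⁻¹) hunit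
    rwa [schrodingerEnergy_smul, inv_pow, inv_mul_eq_div, le_div_iff₀ (by positivity)] at hle

end Scaling

section MinimizingSequence

variable {V W : M → ℝ} {ν y : ℝ}

theorem exists_norm_le_of_eLpNorm_eq_one {q : ENNReal} (hq : 2 ≤ q) :
    ∃ K : ℝ, ∀ v : Lp ℝ 2 μ, eLpNorm v q μ = 1 → ‖v‖ ≤ K := by
  refine ⟨(μ Set.univ ^ (1 / (2 : ENNReal).toReal - 1 / q.toReal)).toReal, fun v hv => ?_⟩
  have hle := eLpNorm_le_eLpNorm_mul_rpow_measure_univ hq (Lp.memLp v).1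
  rw [hv, one_mul] at hle
  refine ENNReal.toReal_mono (ENNReal.rpow_ne_top_of_nonneg ?_ (measure_ne_top _ _)) hle
  rcases eq_or_ne q ⊤ with rfl | hq'
  · simp only [ENNReal.toReal_ofNat, ENNReal.toReal_top, div_zero, sub_zero, one_div, inv_nonneg,
      Nat.ofNat_nonneg]
  · exact sub_nonneg.2 (one_div_le_one_div_of_le two_pos (ENNReal.toReal_mono hq' hq))

theorem two_le_sobolevExponent (hν : 2 < ν) : 2 ≤ sobolevExponent ν := by
  rw [← ENNReal.ofReal_ofNat]
  exact ENNReal.ofReal_le_ofReal (two_lt_two_mul_div_sub_two hν).le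

theorem InfinitesimallyFormBounded.exists_norm_sq_le (hW : E.InfinitesimallyFormBounded W)
    (hVW : ∀ x, 0 ≤ V x + W x) (hν : 2 < ν) :
    ∃ K : ℝ, ∀ w : FormSpace E, toDomain E w ∈ E.schrodingerDomain V →
      eLpNorm (toLp E w) (sobolevExponent ν) μ = 1 →
        ‖w‖ ^ 2 ≤ 2 * E.schrodingerEnergy V (toDomain E w) + K := by
  obtain ⟨c, hc0, hc⟩ := hW.exists_energy_le hVW
  obtain ⟨K, hK⟩ := exists_norm_le_of_eLpNorm_eq_one (μ := μ) (two_le_sobolevExponent hν)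
  refine ⟨(c + 1) * K ^ 2, fun w hw hw1 => ?_⟩
  have hnorm : ‖toDomain E w‖ ^ 2 ≤ K ^ 2 := pow_le_pow_left₀ (norm_nonneg _) (hK _ hw1) 2
  calc ‖w‖ ^ 2 = E.energy (toDomain E w) + ‖toDomain E w‖ ^ 2 := norm_sq E w
    _ ≤ 2 * E.schrodingerEnergy V (toDomain E w) + (c + 1) * ‖toDomain E w‖ ^ 2 := by
        linarith [hc _ hw]
    _ ≤ _ := by gcongr

theorem InfinitesimallyFormBounded.yamabeInvariant_ne_bot (hW : E.InfinitesimallyFormBounded W)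
    (hVW : ∀ x, 0 ≤ V x + W x) (hν : 2 < ν) : E.yamabeInvariant ν V ≠ ⊥ := by
  obtain ⟨K, hK⟩ := hW.exists_norm_sq_le hVW hν
  refine ne_bot_of_le_ne_bot (EReal.coe_ne_bot (-K / 2)) (coe_le_yamabeInvariant_iff.2 ?_)
  intro v hv hv1
  have hbound : 0 ≤ 2 * E.schrodingerEnergy V v + K :=
    (sq_nonneg _).trans (hK ((toDomain E).symm v) hv hv1)
  linarith

theorem exists_seq_tendsto_yamabeInvariant (hy : E.yamabeInvariant ν V = y) :
    ∃ u : ℕ → E.domain, (∀ n, u n ∈ E.schrodingerDomain V) ∧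
      (∀ n, eLpNorm (u n : Lp ℝ 2 μ) (sobolevExponent ν) μ = 1) ∧
      Tendsto (fun n => E.schrodingerEnergy V (u n)) atTop (𝓝 y) := by
  let S : Set E.domain := {v | v ∈ E.schrodingerDomain V ∧
    eLpNorm (v : Lp ℝ 2 μ) (sobolevExponent ν) μ = 1}
  have hsInf : sInf ((fun v => (E.schrodingerEnergy V v : EReal)) '' S) = y :=
    sInf_image.trans hy
  have hS : ((fun v => (E.schrodingerEnergy V v : EReal)) '' S).Nonempty := by
    by_contra hempty
    rw [Set.not_nonempty_iff_eq_empty.1 hempty, sInf_empty] at hsInf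
    exact EReal.coe_ne_top y hsInf.symm
  obtain ⟨t, -, ht, htS⟩ := exists_seq_tendsto_sInf hS (OrderBot.bddBelow _)
  choose u hu hut using htS
  refine ⟨u, fun n => (hu n).1, fun n => (hu n).2, EReal.tendsto_coe.1 ?_⟩
  rw [← hsInf]
  exact ht.congr fun n => (hut n).symm

theorem InfinitesimallyFormBounded.exists_norm_le_of_tendsto
    (hW : E.InfinitesimallyFormBounded W) (hVW : ∀ x, 0 ≤ V x + W x) (hν : 2 < ν)
    {u : ℕ → E.domain} (hu : ∀ n, u n ∈ E.schrodingerDomain V)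
    (hu1 : ∀ n, eLpNorm (u n : Lp ℝ 2 μ) (sobolevExponent ν) μ = 1)
    (hy : Tendsto (fun n => E.schrodingerEnergy V (u n)) atTop (𝓝 y)) :
    ∃ R : ℝ, ∀ n, ‖(toDomain E).symm (u n)‖ ≤ R := by
  obtain ⟨K, hK⟩ := hW.exists_norm_sq_le hVW hν
  obtain ⟨b, hb⟩ := hy.bddAbove_range
  refine ⟨√(2 * b + K), fun n => Real.le_sqrt_of_sq_le ?_⟩
  exact (hK _ (hu n) (hu1 n)).trans (by gcongr; exact hb ⟨n, rfl⟩)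

end MinimizingSequence

section Concentration

variable {V : M → ℝ} {u : ℕ → E.domain} {v : E.domain} {ν A B e y : ℝ}

theorem SobolevInequality.sobolevBound (h : E.SobolevInequality ν A B) :
    E.SobolevBound (2 * ν / (ν - 2)) (max A B) := fun w => by
  refine ⟨(h w).1, (h w).2.trans ?_⟩
  rw [mul_add]
  exact add_le_add (mul_le_mul_of_nonneg_right (le_max_left _ _) (E.nonneg w))
    (mul_le_mul_of_nonneg_right (le_max_right _ _) (sq_nonneg _))

theorem ConvergesWithDefect.eLpNorm_le_one (h : ConvergesWithDefect E u v e) {q : ENNReal}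
    (hu1 : ∀ n, eLpNorm (u n : Lp ℝ 2 μ) q μ = 1) : eLpNorm (v : Lp ℝ 2 μ) q μ ≤ 1 := by
  have hfatou := Lp.eLpNorm_lim_le_liminf_eLpNorm (p := q)
    (fun n => (Lp.memLp (u n : Lp ℝ 2 μ)).1) _ h.tendsto_ae
  simpa only [hu1, liminf_const] using hfatou

theorem ConvergesWithDefect.one_sub_rpow_le (h : ConvergesWithDefect E u v e) (hν : 2 < ν)
    (hSob : E.SobolevInequality ν A B)
    (hu1 : ∀ n, eLpNorm (u n : Lp ℝ 2 μ) (sobolevExponent ν) μ = 1) :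
    1 - (eLpNorm (v : Lp ℝ 2 μ) (sobolevExponent ν) μ).toReal ^ (2 * ν / (ν - 2)) ≤
      (A * e) ^ (2 * ν / (ν - 2) / 2) := by
  have hp := two_lt_two_mul_div_sub_two hν
  have hexponent : sobolevExponent ν = ENNReal.ofReal (2 * ν / (ν - 2)) := rfl
  set p := 2 * ν / (ν - 2)
  have hp0 : 0 < p := by linarith
  have hsub (n : ℕ) : (fun x => |(u n : Lp ℝ 2 μ) x - (v : Lp ℝ 2 μ) x| ^ p) =ᵐ[μ]
      fun x => |((u n - v : E.domain) : Lp ℝ 2 μ) x| ^ p := by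
    filter_upwards [E.coeFn_domain_sub (u n) v] with x hx
    rw [hx]
  have hmass (n : ℕ) : ∫ x, |(u n : Lp ℝ 2 μ) x| ^ p ∂μ = 1 := by
    rw [integral_abs_rpow_eq hp0 (hSob (u n)).1, ← hexponent, hu1, ENNReal.toReal_one,
      Real.one_rpow]
  have hbound : Tendsto (fun n => (A * E.energy (u n - v) + B * ‖u n - v‖ ^ 2) ^ (p / 2)) atTop
      (𝓝 ((A * e) ^ (p / 2))) := by
    have hlim := (h.tendsto_energy_sub.const_mul A).add ((h.tendsto_norm_sub.pow 2).const_mul B)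
    rw [zero_pow two_ne_zero, mul_zero, add_zero] at hlim
    exact hlim.rpow_const (.inr (by positivity))
  have hle := le_integral_abs_rpow_add (by linarith)
    (fun n => integrable_abs_rpow hp0 (hSob (u n)).1) (integrable_abs_rpow hp0 (hSob v).1)
    (fun n => (integrable_abs_rpow hp0 (hSob (u n - v)).1).congr (hsub n).symm)
    (tendsto_const_nhds.congr fun n => (hmass n).symm) (fun n => ?_) hbound h.tendsto_ae
  · rw [integral_abs_rpow_eq hp0 (hSob v).1] at hle
    exact sub_le_iff_le_add'.2 hle
  · rw [integral_congr_ae (hsub n), integral_abs_rpow_eq hp0 (hSob (u n - v)).1]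
    exact rpow_le_rpow_half_of_sq_le ENNReal.toReal_nonneg hp0.le (hSob (u n - v)).2

theorem ConvergesWithDefect.eLpNorm_eq_one (h : ConvergesWithDefect E u v e) (hν : 2 < ν)
    (hA : 0 < A) (hSob : E.SobolevInequality ν A B)
    (hu1 : ∀ n, eLpNorm (u n : Lp ℝ 2 μ) (sobolevExponent ν) μ = 1) (hyA : y < 1 / A)
    (hy : (y : EReal) ≤ E.yamabeInvariant ν V) (hv : v ∈ E.schrodingerDomain V)
    (hve : E.schrodingerEnergy V v + e ≤ y) :
    eLpNorm (v : Lp ℝ 2 μ) (sobolevExponent ν) μ = 1 := by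
  have hp := two_lt_two_mul_div_sub_two hν
  have hmass := h.one_sub_rpow_le hν hSob hu1
  have henergy := mul_eLpNorm_sq_le_schrodingerEnergy hν hy hv (hSob v).1
  have hP1 := ENNReal.toReal_mono ENNReal.one_ne_top (h.eLpNorm_le_one hu1)
  have he := h.defect_nonneg
  rw [← ENNReal.toReal_eq_one_iff]
  set p := 2 * ν / (ν - 2)
  have hp0 : 0 < p := by linarith
  set P := (eLpNorm (v : Lp ℝ 2 μ) (sobolevExponent ν) μ).toReal
  have hP0 : 0 ≤ P := ENNReal.toReal_nonneg
  have hPp : P ^ p ≤ 1 := Real.rpow_le_one hP0 hP1 hp0.le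
  refine (Real.rpow_left_inj hP0 zero_le_one hp0.ne').1 ((Real.one_rpow p).symm ▸ ?_)
  refine eq_one_of_concentration (Real.rpow_nonneg hP0 p) hPp hA hyA (s := 2 / p) (e := e)
    (by positivity) ((div_le_one hp0).2 hp.le) ?_ ?_
  · rw [← Real.rpow_mul hP0, mul_div_cancel₀ _ hp0.ne', Real.rpow_two]
    linarith
  · calc (1 - P ^ p) ^ (2 / p) ≤ ((A * e) ^ (p / 2)) ^ (2 / p) :=
          Real.rpow_le_rpow (sub_nonneg.2 hPp) hmass (by positivity)
      _ = A * e := by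
          rw [← Real.rpow_mul (by positivity), div_mul_div_cancel₀ two_ne_zero, div_self hp0.ne',
            Real.rpow_one]

end Concentration

end DirichletForm

end

theorem mainTheorem1_general {M : Type*} [MeasurableSpace M] {μ : Measure M} [IsFiniteMeasure μ]
    {E : DirichletForm μ} {ν A B : ℝ} (hν : 2 < ν) (hA : 0 < A)
    (hSob : E.SobolevInequality ν A B) {V : M → ℝ}
    (hVneg : E.InfinitesimallyFormBounded (fun x => max 0 (-V x)))
    (hY : E.yamabeInvariant ν V < ((1 / A : ℝ) : EReal)) :
    ∃ v : E.domain, v ∈ E.schrodingerDomain V ∧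
      (E.schrodingerEnergy V v : EReal) = E.yamabeInvariant ν V ∧
      eLpNorm (v : Lp ℝ 2 μ) (sobolevExponent ν) μ = 1 := by
  have hV (x : M) : 0 ≤ V x + max 0 (-V x) := by linarith [le_max_right 0 (-V x)]
  obtain ⟨y, hy⟩ : ∃ y : ℝ, E.yamabeInvariant ν V = y :=
    ⟨_, (EReal.coe_toReal hY.ne_top (hVneg.yamabeInvariant_ne_bot hV hν)).symm⟩
  obtain ⟨u, hu, hu1, hlim⟩ := DirichletForm.exists_seq_tendsto_yamabeInvariant hy
  obtain ⟨R, hR⟩ := hVneg.exists_norm_le_of_tendsto hV hν hu hu1 hlim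
  obtain ⟨v, φ, e, hφ, hconv⟩ := hSob.sobolevBound.exists_subseq_convergesWithDefect
    (DirichletForm.two_lt_two_mul_div_sub_two hν) (hA.le.trans (le_max_left A B)) hR
  obtain ⟨hv, hve⟩ := hconv.schrodingerEnergy_add_le hVneg (fun x => le_max_left _ _) hV
    (fun n => hu (φ n)) (hlim.comp hφ.tendsto_atTop)
  have hyA : y < 1 / A := EReal.coe_lt_coe_iff.1 (hy ▸ hY)
  have hv1 := hconv.eLpNorm_eq_one hν hA hSob (fun n => hu1 (φ n)) hyA hy.ge hv hve
  have he := hconv.defect_nonneg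
  have hle : y ≤ E.schrodingerEnergy V v :=
    DirichletForm.coe_le_yamabeInvariant_iff.1 hy.ge v hv hv1
  refine ⟨v, hv, ?_, hv1⟩
  rw [hy, EReal.coe_eq_coe_iff]
  linarith

theorem mainTheorem1 {M : Type*} [MeasurableSpace M] (μ : Measure M) [IsFiniteMeasure μ]
    (E : DirichletForm μ) (ν A B : ℝ) (hν : 2 < ν) (hA : 0 < A) (hB : 0 < B)
    (hSob : E.SobolevInequality ν A B)
    (V : M → ℝ) (hV : Integrable V μ)
    (hVneg : E.InfinitesimallyFormBounded (fun x => max 0 (-V x)))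
    (hY : E.yamabeInvariant ν V < ((1 / A : ℝ) : EReal)) :
    ∃ v : E.domain, v ∈ E.schrodingerDomain V ∧
      (E.schrodingerEnergy V v : EReal) = E.yamabeInvariant ν V ∧
      eLpNorm (v : Lp ℝ 2 μ) (sobolevExponent ν) μ = 1 :=
  mainTheorem1_general hν hA hSob hVneg hY
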